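/- Let $S=\bigoplus_{n\ge 0}S_n$ be a commutative Noetherian $\mathbb N$-graded ring such that $S_0$ is a local ring with residue field $\mathbb k$, let $\mathfrak m=\mathfrak m_{S_0}\oplus\bigoplus_{n>0}S_n$, so $\mathbb k=S/\mathfrak m$, and let $a\in\mathbb Z$. A differential module $D\in\operatorname{DM}(S,a)$ is a $\mathbb Z$-graded $S$-module with an $S$-linear map $d^D\colon D\to D$ such that $d^D(D_n)\subseteq D_{n+a}$ for all $n$ and $(d^D)^2=0$; its homology is the graded module $H(D)=\ker d^D/\operatorname{im} d^D$. Morphisms are degree-preserving $S$-linear maps commuting with the endomorphisms, and a quasi-isomorphism is a morphism inducing an isomorphism on homology. A free flag is a differential module $F=\bigoplus_{i\ge 0}F_i$ with each $F_i$ graded free and $d^F(F_i)\subseteq\bigoplus_{j<i}F_j$. A minimal free resolution of $D$ is a quasi-isomorphism $G\to D$ with $G$ graded free and $d^G\otimes\mathbb k=0$ that factors as $G\to F\to D$, where $F$ is a free flag, $F\to D$ is a quasi-isomorphism, and $G\to F$ is a split injection of differential modules. The total Betti number is $\beta(D)=\dim_{\mathbb k}H(G\otimes_S\mathbb k)$ for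 any minimal free resolution $G$ of $D$, and $D$ is Betti-deficient if $\beta(D)<\beta(H(D))$, where $H(D)$ is regarded as a differential module with zero endomorphism. Let $D\in\operatorname{DM}(S,a)$ be finitely generated with homology $M=H(D)$, and suppose that the minimal graded free resolution of $M$ is pure of length $\ell$ with degrees $(d_0,\dots,d_\ell)$; that is, it has the form $$0\to S(-d_\ell)^{\beta_\ell}\to\cdots\to S(-d_1)^{\beta_1}\to S(-d_0)^{\beta_0}\to M\to 0,\qquad \beta_i>0 .$$ 1. If $D$ is Betti-deficient, then $$a=\frac{d_{i-j}-d_i}{1-j}\qquad\text{for some integers } 2\le j\le i\le \ell .$$ 2. Suppose that $a=0$, and that $d_0<d_1<\cdots<d_\ell$ or $S_0$ is a field. Then $D$ is not Betti-deficient, and $\beta(D)=\sum_{i=0}^{\ell}\beta_i$. -/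

import Mathlib

open scoped TensorProduct DirectSum

noncomputable section

namespace DiffModule

universe u

/-! ### Homology of a square-zero endomorphism -/

section Homology

variable {R : Type*} [CommRing R] {M N : Type*} [AddCommGroup M] [Module R M]
  [AddCommGroup N] [Module R N]

/-- The homology `ker d / im d` of an endomorphism `d` (used when `d ∘ d = 0`, so that the image
of `d` lies in its kernel). -/
abbrev Hlgy (d : M →ₗ[R] M) : Type _ :=
  LinearMap.ker d ⧸ (LinearMap.range d).submoduleOf (LinearMap.ker d)

/-- The map `ker d → ker d'` induced by a linear map that commutes with `d` and `d'`. -/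
def kerMap (d : M →ₗ[R] M) (d' : N →ₗ[R] N) (f : M →ₗ[R] N)
    (hf : ∀ m, f (d m) = d' (f m)) : LinearMap.ker d →ₗ[R] LinearMap.ker d' :=
  f.restrict (fun m hm => by
    rw [LinearMap.mem_ker] at hm ⊢
    rw [← hf, hm, map_zero])

/-- The map on homology induced by a linear map that commutes with `d` and `d'`. -/
def hlgyMap (d : M →ₗ[R] M) (d' : N →ₗ[R] N) (f : M →ₗ[R] N)
    (hf : ∀ m, f (d m) = d' (f m)) : Hlgy d →ₗ[R] Hlgy d' :=
  Submodule.mapQ _ _ (kerMap d d' f hf) (by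
    rintro ⟨z, hz⟩ ⟨w, hw⟩
    refine ⟨f w, ?_⟩
    have hw' : d w = z := hw
    change d' (f w) = f z
    rw [← hf, hw'])

end Homology

/-! ### The graded-local base ring -/

section Ring

variable {S : Type u} [CommRing S] (𝒜 : ℕ → AddSubgroup S) [GradedRing 𝒜] [IsLocalRing (𝒜 0)]

/-- The homogeneous maximal ideal of an `ℕ`-graded ring whose degree zero component is local:
the elements whose degree zero component is not a unit of `𝒜 0`. -/
def homMaxIdeal : Ideal S :=
  (IsLocalRing.maximalIdeal (𝒜 0)).comap (GradedRing.projZeroRingHom' 𝒜)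

/-- The residue field `𝕜`, as a quotient of `S`. -/
abbrev ResField : Type u := S ⧸ homMaxIdeal 𝒜

end Ring

/-! ### Graded modules -/

/-- A `ℤ`-graded module over an `ℕ`-graded ring. -/
structure GrMod {S : Type u} [CommRing S] (𝒜 : ℕ → AddSubgroup S) : Type (u + 1) where
  carrier : Type u
  [addCommGroup : AddCommGroup carrier]
  [module : Module S carrier]
  piece : ℤ → AddSubgroup carrier
  isInternal : DirectSum.IsInternal piece
  smul_mem : ∀ (i : ℕ) (n : ℤ) (s : S) (m : carrier),
    s ∈ 𝒜 i → m ∈ piece n → s • m ∈ piece ((i : ℤ) + n)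

attribute [instance] GrMod.addCommGroup GrMod.module

section GrMod

variable {S : Type u} [CommRing S] {𝒜 : ℕ → AddSubgroup S}

instance : CoeSort (GrMod 𝒜) (Type u) := ⟨GrMod.carrier⟩

/-- A linear map is graded (of degree `0`) if it preserves the grading. -/
def IsGradedMap (M N : GrMod 𝒜) (f : M →ₗ[S] N) : Prop :=
  ∀ (n : ℤ) (m : M), m ∈ M.piece n → f m ∈ N.piece n

/-- A graded module is graded free if it has a basis of homogeneous elements. -/
def GrMod.IsFree (M : GrMod 𝒜) : Prop :=
  ∃ (ι : Type u) (b : Module.Basis ι S M), ∀ i, ∃ n : ℤ, b i ∈ M.piece n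

end GrMod

/-! ### Differential modules -/

/-- A differential module of degree `a`: a graded module with a square-zero endomorphism that
raises the degree by `a`, i.e. a graded map `D → D(a)`. -/
structure DM {S : Type u} [CommRing S] (𝒜 : ℕ → AddSubgroup S) (a : ℤ) : Type (u + 1)
    extends GrMod 𝒜 where
  d : carrier →ₗ[S] carrier
  d_mem : ∀ (n : ℤ) (m : carrier), m ∈ piece n → d m ∈ piece (n + a)
  d_d : ∀ m : carrier, d (d m) = 0

section DM

variable {S : Type u} [CommRing S] {𝒜 : ℕ → AddSubgroup S} {a : ℤ}

instance : CoeSort (DM 𝒜 a) (Type u) := ⟨fun D => D.carrier⟩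

namespace DM

/-- The degree `n` part of the homology: classes of cycles of degree `n`. -/
def homologyPiece (D : DM 𝒜 a) (n : ℤ) : AddSubgroup (Hlgy D.d) :=
  ((D.piece n).comap (LinearMap.ker D.d).subtype.toAddMonoidHom).map
    (Submodule.mkQ ((LinearMap.range D.d).submoduleOf (LinearMap.ker D.d))).toAddMonoidHom

theorem mem_homologyPiece (D : DM 𝒜 a) (n : ℤ) (x : Hlgy D.d) :
    x ∈ D.homologyPiece n ↔
      ∃ z : LinearMap.ker D.d, (z : D) ∈ D.piece n ∧ Submodule.Quotient.mk z = x :=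
  Iff.rfl

theorem homology_isInternal (D : DM 𝒜 a) : DirectSum.IsInternal D.homologyPiece := by
  classical
  let dec : DirectSum.Decomposition D.piece := D.isInternal.chooseDecomposition
  -- the endomorphism `d` shifts homogeneous components by `a`
  have key : ∀ (m : D) (n : ℤ),
      (DirectSum.decompose D.piece (D.d m) n : D)
        = D.d (DirectSum.decompose D.piece m (n - a) : D) := by
    intro m n
    induction m using DirectSum.Decomposition.inductionOn D.piece with
    | zero => simp
    | @homogeneous i m =>
      have hm := D.d_mem i m m.2
      by_cases h : i + a = n
      · subst h
        rw [DirectSum.decompose_of_mem_same _ hm, add_sub_cancel_right,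
          DirectSum.decompose_of_mem_same _ m.2]
      · rw [DirectSum.decompose_of_mem_ne _ hm h,
          DirectSum.decompose_of_mem_ne _ m.2 (fun h' => h (by omega)), map_zero]
    | add m m' h h' =>
      rw [map_add, DirectSum.decompose_add, DirectSum.decompose_add, DirectSum.add_apply,
        DirectSum.add_apply, AddSubgroup.coe_add, AddSubgroup.coe_add, h, h', map_add]
  have hker : ∀ (z : LinearMap.ker D.d) (n : ℤ),
      (DirectSum.decompose D.piece (z : D) n : D) ∈ LinearMap.ker D.d := by
    intro z n
    have h := key z (n + a)
    rw [add_sub_cancel_right, LinearMap.mem_ker.1 z.2] at h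
    rw [LinearMap.mem_ker, ← h]
    simp
  constructor
  · rw [injective_iff_map_eq_zero]
    intro x hx
    choose z hz hzx using fun n => (D.mem_homologyPiece n (x n)).1 (x n).2
    rw [DirectSum.coeAddMonoidHom_eq_dfinsuppSum, DFinsupp.sum] at hx
    have hx' : (Submodule.Quotient.mk (∑ i ∈ DFinsupp.support x, z i) : Hlgy D.d) = 0 := by
      rw [← hx, ← Submodule.mkQ_apply, map_sum]
      exact Finset.sum_congr rfl fun i _ => hzx i
    rw [Submodule.Quotient.mk_eq_zero] at hx'
    obtain ⟨w, hw⟩ := hx'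
    have hw' : D.d w = ∑ i ∈ DFinsupp.support x, (z i : D) := by
      rw [hw]; simp
    ext n
    by_cases hn : n ∈ DFinsupp.support x
    · have h := key w n
      rw [hw', DirectSum.decompose_sum, DFinsupp.finsetSum_apply, AddSubmonoidClass.coe_finsetSum,
        Finset.sum_eq_single n (fun i _ hi => DirectSum.decompose_of_mem_ne _ (hz i) hi)
          (fun h => absurd hn h), DirectSum.decompose_of_mem_same _ (hz n)] at h
      have : (x n : Hlgy D.d) = 0 := by
        rw [← hzx n, Submodule.Quotient.mk_eq_zero]
        exact ⟨_, h.symm⟩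
      simpa using this
    · rw [DFinsupp.notMem_support_iff] at hn
      rw [hn]
      simp
  · intro y
    obtain ⟨z, rfl⟩ := Submodule.Quotient.mk_surjective _ y
    refine ⟨∑ i ∈ (DirectSum.decompose D.piece (z : D)).support,
      DirectSum.of (fun n => D.homologyPiece n) i
        ⟨Submodule.Quotient.mk ⟨_, hker z i⟩, ⟨_, hker z i⟩,
          (DirectSum.decompose D.piece (z : D) i).2, rfl⟩, ?_⟩
    rw [map_sum]
    simp only [DirectSum.coeAddMonoidHom_of]
    simp only [← Submodule.mkQ_apply]
    rw [← map_sum]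
    congr 1
    ext
    rw [AddSubmonoidClass.coe_finsetSum]
    exact DirectSum.sum_support_decompose D.piece (z : D)

/-- The homology of a differential module, as a graded module. -/
def homology (D : DM 𝒜 a) : GrMod 𝒜 where
  carrier := Hlgy D.d
  piece := D.homologyPiece
  isInternal := D.homology_isInternal
  smul_mem := by
    rintro i n s _ hs ⟨z, hz, rfl⟩
    exact ⟨s • z, D.smul_mem i n s z hs hz, rfl⟩

/-- Morphisms of `DM(S, a)`: graded linear maps that commute with the endomorphisms. -/
structure Hom (D E : DM 𝒜 a) where
  toFun : D →ₗ[S] E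
  graded : IsGradedMap D.toGrMod E.toGrMod toFun
  comm : ∀ m : D, toFun (D.d m) = E.d (toFun m)

/-- A morphism of differential modules is a quasi-isomorphism if it induces an isomorphism on
homology. -/
def Hom.IsQuasiIso {D E : DM 𝒜 a} (f : Hom D E) : Prop :=
  Function.Bijective (hlgyMap D.d E.d f.toFun f.comm)

/-- The composite of two morphisms of differential modules. -/
def Hom.comp {D E F : DM 𝒜 a} (g : Hom E F) (f : Hom D E) : Hom D F where
  toFun := g.toFun ∘ₗ f.toFun
  graded := fun n m hm => g.graded n _ (f.graded n m hm)
  comm := fun m => by simp [f.comm, g.comm]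

/-- A free flag: `D = ⨁ F_i` with `F_i` graded free for `i ∈ ℕ` and `d (F_i) ⊆ ⨁_{j < i} F_j`.
It is expressed through a homogeneous basis of `D` in which every basis element carries a level;
`F_i` is the span of the basis elements of level `i`. -/
def IsFreeFlag (D : DM 𝒜 a) : Prop :=
  ∃ (ι : Type u) (b : Module.Basis ι S D) (level : ι → ℕ),
    (∀ r, ∃ n : ℤ, b r ∈ D.piece n) ∧
    ∀ r, D.d (b r) ∈ Submodule.span S (b '' {s | level s < level r})

/-- A graded module, viewed as a differential module of degree `a` with zero endomorphism. -/
def ofGrMod (a : ℤ) (M : GrMod 𝒜) : DM 𝒜 a where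
  toGrMod := M
  d := 0
  d_mem := fun _ _ _ => by simp
  d_d := fun _ => by simp

variable [GradedRing 𝒜] [IsLocalRing (𝒜 0)]

/-- The endomorphism `d ⊗ 𝕜` of `D ⊗ 𝕜`. -/
def dRes (D : DM 𝒜 a) :
    ResField 𝒜 ⊗[S] D.carrier →ₗ[ResField 𝒜] ResField 𝒜 ⊗[S] D.carrier :=
  D.d.baseChange (ResField 𝒜)

/-- A differential module is minimal if `d ⊗ 𝕜 = 0`. -/
def IsMinimal (D : DM 𝒜 a) : Prop := D.dRes = 0

/-- `G` is a minimal free resolution of `D`: it is free and minimal, and there is a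
quasi-isomorphism `G → D` that factors as `G → F → D`, where `F → D` is a free flag resolution
(a quasi-isomorphism from a free flag) and `G → F` is a split injection of differential
modules. -/
def IsMinimalFreeResolution (G D : DM 𝒜 a) : Prop :=
  G.toGrMod.IsFree ∧ G.IsMinimal ∧
    ∃ (F : DM 𝒜 a) (q : Hom F D) (i : Hom G F) (p : Hom F G),
      F.IsFreeFlag ∧ q.IsQuasiIso ∧ (∀ x : G, p.toFun (i.toFun x) = x) ∧ (q.comp i).IsQuasiIso

/-- The dimension over `𝕜` of `H(F ⊗ 𝕜)`, the sum of the dimensions of its homogeneous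
components. -/
def resDim (F : DM 𝒜 a) : ℕ∞ :=
  Cardinal.toENat (Module.rank (ResField 𝒜) (Hlgy F.dRes))

/-- The total Betti number of `D`: the dimension of `H(F ⊗ 𝕜)` for any minimal free resolution `F`
of `D`. This dimension does not depend on the choice of `F`; the infimum selects the common
value. -/
def totalBetti (D : DM 𝒜 a) : ℕ∞ :=
  ⨅ (F : DM 𝒜 a) (_ : F.IsMinimalFreeResolution D), F.resDim

/-- `D` is Betti-deficient if `β(D) < β(H(D))`, where `H(D)` is viewed as a differential module
with zero endomorphism. -/
def IsBettiDeficient (D : DM 𝒜 a) : Prop :=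
  D.totalBetti < (ofGrMod a D.homology).totalBetti

end DM

end DM

/-! ### Minimal and pure resolutions of graded modules -/

section Resolution

variable {S : Type u} [CommRing S] {𝒜 : ℕ → AddSubgroup S} [GradedRing 𝒜] [IsLocalRing (𝒜 0)]

/-- A minimal graded free resolution `⋯ → F 1 → F 0 → M → 0` by finitely generated graded free
modules. -/
structure MinFreeRes (M : GrMod 𝒜) : Type (u + 1) where
  F : ℕ → GrMod 𝒜
  free : ∀ i, (F i).IsFree
  finite : ∀ i, Module.Finite S (F i)
  δ : ∀ i, F (i + 1) →ₗ[S] F i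
  δ_graded : ∀ i, IsGradedMap (F (i + 1)) (F i) (δ i)
  ε : F 0 →ₗ[S] M
  ε_graded : IsGradedMap (F 0) M ε
  ε_surjective : Function.Surjective ε
  exact_zero : Function.Exact (δ 0) ε
  exact_succ : ∀ i, Function.Exact (δ (i + 1)) (δ i)
  minimal : ∀ i, (δ i).baseChange (ResField 𝒜) = 0

/-- The `i`-th Betti number of `M`, read off from a minimal free resolution. -/
def MinFreeRes.betti {M : GrMod 𝒜} (P : MinFreeRes M) (i : ℕ) : ℕ := Module.finrank S (P.F i)

/-- The resolution is pure of length `ℓ` with degrees `d 0, …, d ℓ`: for `i ≤ ℓ` the module `F i` is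
a nonzero direct sum of copies of `S(- d i)`, and `F i = 0` for `i > ℓ`. -/
def MinFreeRes.IsPure {M : GrMod 𝒜} (P : MinFreeRes M) (ℓ : ℕ) (d : ℕ → ℤ) : Prop :=
  (∀ i ≤ ℓ, ∃ (n : ℕ) (b : Module.Basis (Fin n) S (P.F i)),
    0 < n ∧ ∀ r, b r ∈ (P.F i).piece (d i)) ∧
  ∀ i, ℓ < i → Subsingleton (P.F i)

end Resolution

end DiffModule

end

noncomputable section

namespace DiffModule

universe u

/-! ### Null-homotopies and lifting for free flags -/

/-! From the resolution `F 0 ← F 1 ← ⋯` of `H(D)` one builds a free flag on `⨁ F i` that resolves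
`D`. Generators of `F i` are placed in degree `d i - i * a`. The block `F i → F (i - 1)` of the
differential is `δ` up to sign, and the blocks `F i → F (i - j)` with `j ≥ 2` are corrections whose
entries are homogeneous of degree `d i - d (i - j) + a * (1 - j)`. If no such degree vanishes, every
entry lies in the homogeneous maximal ideal. The flag is then minimal, hence its own minimal free
resolution, and `β(D)` is the sum of the ranks. The same resolution serves `H(D)`, so the two Betti
numbers agree. Part 1 is the contrapositive. In Part 2 the degrees are `d i - d (i - j)`, which are
nonzero when `d` increases; over a field `S₀` minimality forces `d` to increase.

The flag is built through its mapping cone (`exists_good`). Let `C k = D ⊕ F 0 ⊕ ⋯ ⊕ F (k-1)`, with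
homology identified with the cokernel of `δ k`. Lifting `F k → H(C k)` to cycles on a basis attaches
`F k`, and exactness of the resolution gives the homology of `C (k + 1)` (`ExactAt.succ`). Each
cycle of `C k` bounds in `C (k + 1)`, so the union is acyclic and the flag maps quasi-isomorphically
to `D`.

Since `totalBetti` is an infimum, the flag must also be compared with every other minimal free
resolution. This is `IsFreeFlag.resDim_le`, which rests on lifting maps out of flags through
quasi-isomorphisms up to homotopy. -/

theorem exists_of_level_step {ι : Type*} {X : ι → Type*} [∀ r, Nonempty (X r)] (level : ι → ℕ)
    (Q : ℕ → (∀ r, X r) → Prop)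
    (hQ : ∀ n f g, (∀ r, level r < n → g r = f r) → Q n f → Q n g)
    (h0 : ∀ f, Q 0 f)
    (step : ∀ n f, Q n f → ∃ g, (∀ r, level r < n → g r = f r) ∧ Q (n + 1) g) :
    ∃ f, ∀ n, Q n f := by
  choose! nxt hnxt hQnxt using step
  let f : ℕ → ∀ r, X r := fun n =>
    Nat.rec (motive := fun _ => ∀ r, X r) (fun _ => Classical.arbitrary _) (fun n g => nxt n g) n
  have hf : ∀ n, Q n (f n) := by
    intro n
    induction n with
    | zero => exact h0 _
    | succ n ih => exact hQnxt n _ ih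
  have hst : ∀ r k, f (level r + 1 + k) r = f (level r + 1) r := by
    intro r k
    induction k with
    | zero => rfl
    | succ k ih =>
      rw [← ih]
      exact hnxt _ _ (hf _) r (lt_of_lt_of_le (Nat.lt_succ_self _) (Nat.le_add_right _ _))
  -- Passing from stage `n` to `n + 1` leaves levels below `n` alone, so the value at `r` is frozen
  -- from stage `level r + 1` on.
  refine ⟨fun r => f (level r + 1) r, fun n => hQ n (f n) _ (fun r hr => ?_) (hf n)⟩
  obtain ⟨k, rfl⟩ := Nat.exists_eq_add_of_lt hr
  rw [add_right_comm, hst]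

section Ungraded

variable {S : Type*} [CommRing S]
variable {F A B E : Type*} [AddCommGroup F] [Module S F] [AddCommGroup A] [Module S A]
  [AddCommGroup B] [Module S B] [AddCommGroup E] [Module S E]

/-- The homotopy is chosen on basis elements by induction on the level: `dF (b r)` involves lower
levels only, so the obstruction at `b r` is already defined, and it is a cycle of the acyclic
target. -/
theorem exists_nullHomotopy {ι : Type*} {dF : F →ₗ[S] F} {dE : E →ₗ[S] E}
    (hF : ∀ x, dF (dF x) = 0) (hE : ∀ x, dE x = 0 → ∃ y, dE y = x)
    (b : Module.Basis ι S F) (level : ι → ℕ)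
    (hb : ∀ r, dF (b r) ∈ Submodule.span S (b '' {s | level s < level r}))
    (v : F →ₗ[S] E) (hv : ∀ x, v (dF x) = dE (v x)) :
    ∃ h : F →ₗ[S] E, ∀ x, dE (h x) + h (dF x) = v x := by
  have agree : ∀ (n : ℕ) (f g : ι → E), (∀ r, level r < n → g r = f r) →
      ∀ x ∈ Submodule.span S (b '' {s | level s < n}), b.constr S g x = b.constr S f x := by
    intro n f g hfg x hx
    induction hx using Submodule.span_induction with
    | mem x hx =>
      obtain ⟨s, hs, rfl⟩ := hx
      simpa [Module.Basis.constr_basis] using hfg s hs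
    | zero => simp
    | add x y _ _ hx hy => rw [map_add, map_add, hx, hy]
    | smul c x _ hx => rw [map_smul, map_smul, hx]
  obtain ⟨h, hh⟩ := exists_of_level_step (X := fun _ => E) level
    (fun n h => ∀ r, level r < n → dE (h r) + b.constr S h (dF (b r)) = v (b r))
    (fun n f g hfg hf r hr => by
      rw [hfg r hr, agree (level r) f g (fun s hs => hfg s (hs.trans hr)) _ (hb r), hf r hr])
    (fun f r hr => absurd hr (Nat.not_lt_zero _))
    (by
      intro n f hf
      have hspan : ∀ x ∈ Submodule.span S (b '' {s | level s < n}),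
          dE (b.constr S f x) + b.constr S f (dF x) = v x := by
        intro x hx
        induction hx using Submodule.span_induction with
        | mem x hx =>
          obtain ⟨s, hs, rfl⟩ := hx
          simpa [Module.Basis.constr_basis] using hf s hs
        | zero => simp
        | add x y _ _ hx hy => simp only [map_add]; rw [← hx, ← hy]; abel
        | smul c x _ hx => simp only [map_smul]; rw [← hx, smul_add]
      -- The homotopy identity at `dF (b r)` loses its second term because `dF` squares to zero;
      -- what remains says that this difference is a cycle.
      have hcyc : ∀ r, level r = n → ∃ y, dE y = v (b r) - b.constr S f (dF (b r)) := by
        intro r hr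
        apply hE
        have := hspan _ (hr ▸ hb r)
        rw [hF, map_zero, add_zero] at this
        rw [map_sub, this, hv, sub_self]
      choose y hy using hcyc
      classical
      refine ⟨fun r => if hr : level r = n then y r hr else f r,
        fun r hr => dif_neg hr.ne, fun r hr => ?_⟩
      rw [agree n f _ (fun r hr => dif_neg hr.ne) (dF (b r))
        (Submodule.span_mono (Set.image_mono fun s hs => lt_of_lt_of_le hs (Nat.lt_succ_iff.1 hr))
          (hb r))]
      beta_reduce
      by_cases h : level r = n
      · rw [dif_pos h, hy, sub_add_cancel]
      · rw [dif_neg h]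
        exact hf r (by omega))
  refine ⟨b.constr S h, fun x => ?_⟩
  have : dE ∘ₗ b.constr S h + b.constr S h ∘ₗ dF = v := by
    refine b.ext fun r => ?_
    simpa [Module.Basis.constr_basis] using hh _ r (Nat.lt_succ_self _)
  exact LinearMap.congr_fun this x

/-- An elementwise form of the statement that `φ` induces an isomorphism on homology. -/
def IsHlgyIso (dA : A →ₗ[S] A) (dB : B →ₗ[S] B) (φ : A →ₗ[S] B) : Prop :=
  (∀ x y, dA x = 0 → φ x = dB y → ∃ x', dA x' = x) ∧
    ∀ y, dB y = 0 → ∃ x y', dA x = 0 ∧ φ x + dB y' = y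

theorem bijective_hlgyMap_iff {dA : A →ₗ[S] A} {dB : B →ₗ[S] B} {φ : A →ₗ[S] B}
    (hφ : ∀ x, φ (dA x) = dB (φ x)) :
    Function.Bijective (hlgyMap dA dB φ hφ) ↔ IsHlgyIso dA dB φ := by
  refine and_congr ?_ ?_
  · rw [injective_iff_map_eq_zero]
    constructor
    · intro h x y hx hxy
      have := h (Submodule.Quotient.mk ⟨x, hx⟩) (by
        rw [← Submodule.mkQ_apply, hlgyMap, Submodule.mkQ_apply, Submodule.mapQ_apply,
          Submodule.Quotient.mk_eq_zero]
        exact ⟨y, hxy.symm⟩)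
      rw [Submodule.Quotient.mk_eq_zero] at this
      exact this
    · intro h x hx
      obtain ⟨⟨x, hxk⟩, rfl⟩ := Submodule.Quotient.mk_surjective _ x
      rw [hlgyMap, Submodule.mapQ_apply, Submodule.Quotient.mk_eq_zero] at hx
      obtain ⟨y, hy⟩ := hx
      rw [Submodule.Quotient.mk_eq_zero]
      exact h x y hxk hy.symm
  · constructor
    · intro h y hy
      obtain ⟨x, hx⟩ := h (Submodule.Quotient.mk ⟨y, hy⟩)
      obtain ⟨⟨x, hxk⟩, rfl⟩ := Submodule.Quotient.mk_surjective _ x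
      rw [hlgyMap, Submodule.mapQ_apply, eq_comm, Submodule.Quotient.eq] at hx
      obtain ⟨y', hy'⟩ := hx
      refine ⟨x, y', hxk, ?_⟩
      rw [hy']
      exact add_sub_cancel _ _
    · intro h y
      obtain ⟨⟨y, hy⟩, rfl⟩ := Submodule.Quotient.mk_surjective _ y
      obtain ⟨x, y', hx, hxy⟩ := h y hy
      refine ⟨Submodule.Quotient.mk ⟨x, hx⟩, ?_⟩
      rw [hlgyMap, Submodule.mapQ_apply, eq_comm, Submodule.Quotient.eq]
      exact ⟨y', eq_sub_of_add_eq' hxy⟩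

/-- The endomorphism of the mapping cone of `φ`. -/
def coneD (dA : A →ₗ[S] A) (dB : B →ₗ[S] B) (φ : A →ₗ[S] B) : (A × B) →ₗ[S] (A × B) :=
  ((-dA) ∘ₗ LinearMap.fst S A B).prod (φ ∘ₗ LinearMap.fst S A B + dB ∘ₗ LinearMap.snd S A B)

theorem coneD_apply (dA : A →ₗ[S] A) (dB : B →ₗ[S] B) (φ : A →ₗ[S] B) (z : A × B) :
    coneD dA dB φ z = (-dA z.1, φ z.1 + dB z.2) := rfl

/-- For a cycle `(x, y)`, injectivity on homology gives `x = dA x'`; surjectivity writes the cycle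
`y + φ x'` as `φ u + dB v`, and `(u - x', v)` bounds. -/
theorem IsHlgyIso.cone_acyclic {dA : A →ₗ[S] A} {dB : B →ₗ[S] B} {φ : A →ₗ[S] B}
    (hφ : IsHlgyIso dA dB φ) (hc : ∀ x, φ (dA x) = dB (φ x)) (z : A × B)
    (hz : coneD dA dB φ z = 0) : ∃ w, coneD dA dB φ w = z := by
  obtain ⟨x, y⟩ := z
  rw [coneD_apply, Prod.mk_eq_zero, neg_eq_zero] at hz
  obtain ⟨x', hx'⟩ := hφ.1 x (-y) hz.1 (by rw [map_neg]; exact eq_neg_of_add_eq_zero_left hz.2)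
  obtain ⟨u, v, hu, huv⟩ := hφ.2 (y + φ x') (by rw [map_add, ← hc, hx', add_comm]; exact hz.2)
  refine ⟨(u - x', v), ?_⟩
  rw [coneD_apply]
  simp only [map_sub, hu, hx', zero_sub, neg_neg, Prod.mk.injEq, true_and]
  rw [sub_add_eq_add_sub, huv, add_sub_cancel_right]

/-- A chain map from a free flag lifts, up to homotopy, through a quasi-isomorphism. -/
theorem IsHlgyIso.exists_lift {ι : Type*} {dF : F →ₗ[S] F} {dA : A →ₗ[S] A} {dB : B →ₗ[S] B}
    {φ : A →ₗ[S] B} (hφ : IsHlgyIso dA dB φ) (hc : ∀ x, φ (dA x) = dB (φ x))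
    (hF : ∀ x, dF (dF x) = 0) (b : Module.Basis ι S F) (level : ι → ℕ)
    (hb : ∀ r, dF (b r) ∈ Submodule.span S (b '' {s | level s < level r}))
    (f : F →ₗ[S] B) (hf : ∀ x, f (dF x) = dB (f x)) :
    ∃ (g : F →ₗ[S] A) (s : F →ₗ[S] B), (∀ x, g (dF x) = dA (g x)) ∧
      ∀ x, φ (g x) + (dB (s x) + s (dF x)) = f x := by
  -- A null-homotopy of `(0, f)` into the cone has components `(g, s)`: its first equation says that
  -- `g` is a chain map, its second is the homotopy between `φ ∘ g` and `f`.
  obtain ⟨h, hh⟩ := exists_nullHomotopy hF (hφ.cone_acyclic hc) b level hb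
    ((LinearMap.inr S A B) ∘ₗ f) (fun x => by simp [coneD_apply, hf])
  refine ⟨LinearMap.fst S A B ∘ₗ h, LinearMap.snd S A B ∘ₗ h, fun x => ?_, fun x => ?_⟩
  · have := congrArg Prod.fst (hh x)
    simp only [coneD_apply, Prod.fst_add, LinearMap.comp_apply, LinearMap.inr_apply] at this
    exact (neg_add_eq_zero.1 this).symm
  · have := congrArg Prod.snd (hh x)
    simp only [coneD_apply, Prod.snd_add, LinearMap.comp_apply, LinearMap.inr_apply] at this
    rw [← this]
    simp only [LinearMap.comp_apply, LinearMap.fst_apply, LinearMap.snd_apply]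
    abel

/-- A chain map from a free flag that becomes null-homotopic after a quasi-isomorphism is
null-homotopic. -/
theorem IsHlgyIso.exists_nullHomotopy {ι : Type*} {dF : F →ₗ[S] F} {dA : A →ₗ[S] A}
    {dB : B →ₗ[S] B} {φ : A →ₗ[S] B} (hφ : IsHlgyIso dA dB φ) (hc : ∀ x, φ (dA x) = dB (φ x))
    (hF : ∀ x, dF (dF x) = 0) (b : Module.Basis ι S F) (level : ι → ℕ)
    (hb : ∀ r, dF (b r) ∈ Submodule.span S (b '' {s | level s < level r}))
    (u : F →ₗ[S] A) (hu : ∀ x, u (dF x) = dA (u x)) (s : F →ₗ[S] B)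
    (hs : ∀ x, φ (u x) = dB (s x) + s (dF x)) :
    ∃ t : F →ₗ[S] A, ∀ x, u x = dA (t x) + t (dF x) := by
  -- Because the cone carries `-dA`, the map `(u, -s)` anticommutes with the differentials;
  -- replacing `dF` by `-dF` restores commutation.
  obtain ⟨h, hh⟩ := DiffModule.exists_nullHomotopy (dF := -dF) (by simp [hF])
    (hφ.cone_acyclic hc) b level (fun r => by simpa using hb r)
    (u.prod (-s)) (fun x => by simp [coneD_apply, hu, hs])
  refine ⟨-(LinearMap.fst S A B ∘ₗ h), fun x => ?_⟩
  have := congrArg Prod.fst (hh x)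
  simp only [coneD_apply, Prod.fst_add, LinearMap.neg_apply, map_neg, Prod.fst_neg,
    LinearMap.prod_apply] at this
  simp only [LinearMap.neg_apply, LinearMap.comp_apply, LinearMap.fst_apply, map_neg]
  exact this.symm

end Ungraded

/-! ### Comparison of resolutions after reduction to the residue field -/

namespace DM

variable {S : Type u} [CommRing S] {𝒜 : ℕ → AddSubgroup S} {a : ℤ}

theorem Hom.isQuasiIso_iff {D E : DM 𝒜 a} (f : Hom D E) :
    f.IsQuasiIso ↔ IsHlgyIso D.d E.d f.toFun :=
  bijective_hlgyMap_iff f.comm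

variable [GradedRing 𝒜] [IsLocalRing (𝒜 0)]

/-- A free flag resolution of `D` has the smallest value of `dim H(- ⊗ 𝕜)` among the minimal free
resolutions. -/
theorem IsFreeFlag.resDim_le {F G D : DM 𝒜 a} (hF : F.IsFreeFlag) (φ : Hom F D)
    (hφ : φ.IsQuasiIso) (hG : G.IsMinimalFreeResolution D) : F.resDim ≤ G.resDim := by
  obtain ⟨-, -, F', q, i, p, ⟨ι', b', level', -, hb'⟩, -, hpi, hγ⟩ := hG
  obtain ⟨ι, b, level, -, hb⟩ := hF
  set γ : Hom G D := q.comp i with hγdef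
  rw [Hom.isQuasiIso_iff] at hφ hγ
  obtain ⟨f, s, hf, hfs⟩ := hγ.exists_lift γ.comm F.d_d b level hb φ.toFun φ.comm
  -- Lifting needs a flag as source, so the map `G → F` is obtained by lifting `γ ∘ p` on `F'` and
  -- restricting along the split injection `i`.
  obtain ⟨h', s', hh', hhs'⟩ := hφ.exists_lift φ.comm F'.d_d b' level' hb' (γ.toFun ∘ₗ p.toFun)
    (fun x => by simp [p.comm, γ.comm])
  set h : G.carrier →ₗ[S] F.carrier := h' ∘ₗ i.toFun with hdef
  have hh : ∀ x, h (G.d x) = F.d (h x) := fun x => by simp [hdef, i.comm, hh']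
  -- Up to homotopy `φ h f ≃ γ p i f = γ f ≃ φ`, so `φ ∘ (h f - 1)` is null-homotopic, and `φ` can
  -- be cancelled.
  obtain ⟨t, ht⟩ := hφ.exists_nullHomotopy φ.comm F.d_d b level hb
    (h ∘ₗ f - LinearMap.id) (fun x => by simp [hf, hh])
    (-(s' ∘ₗ i.toFun ∘ₗ f) - s) (fun x => by
      have h1 := hhs' (i.toFun (f x))
      have h2 := hfs x
      simp only [LinearMap.comp_apply, hpi] at h1
      simp only [LinearMap.sub_apply, LinearMap.neg_apply, LinearMap.comp_apply, map_sub, map_neg,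
        LinearMap.id_apply, hdef, hf, i.comm]
      rw [← h2, ← h1]
      abel)
  have ht' : h ∘ₗ f = LinearMap.id + (F.d ∘ₗ t + t ∘ₗ F.d) := by
    ext x
    simpa [sub_eq_iff_eq_add'] using ht x
  have hfd : f ∘ₗ F.d = G.d ∘ₗ f := LinearMap.ext hf
  have hhd : h ∘ₗ G.d = F.d ∘ₗ h := LinearMap.ext hh
  have base := congrArg (LinearMap.baseChange (ResField 𝒜)) ht'
  have basef := congrArg (LinearMap.baseChange (ResField 𝒜)) hfd
  have baseh := congrArg (LinearMap.baseChange (ResField 𝒜)) hhd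
  simp only [LinearMap.baseChange_comp, LinearMap.baseChange_add, LinearMap.baseChange_id]
    at base basef baseh
  have hinj : Function.Injective
      (hlgyMap F.dRes G.dRes (f.baseChange _) (fun m => LinearMap.congr_fun basef m)) := by
    rw [injective_iff_map_eq_zero]
    intro x hx
    obtain ⟨⟨x, hxk⟩, rfl⟩ := Submodule.Quotient.mk_surjective _ x
    obtain ⟨w, hw⟩ := (Submodule.Quotient.mk_eq_zero _).1 hx
    replace hw : G.dRes w = f.baseChange _ x := hw
    rw [Submodule.Quotient.mk_eq_zero]
    -- If `d x = 0` and `f x = d w`, then `d (h w) = h (f x) = x + d (t x)`.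
    refine ⟨h.baseChange _ w - t.baseChange _ x, ?_⟩
    change F.dRes _ = x
    have e1 := LinearMap.congr_fun base x
    have e2 := LinearMap.congr_fun baseh w
    have hx0 : F.d.baseChange (ResField 𝒜) x = 0 := hxk
    simp only [LinearMap.comp_apply, LinearMap.add_apply, LinearMap.id_apply, hx0, map_zero,
      add_zero] at e1 e2
    rw [map_sub]
    change F.d.baseChange _ _ - F.d.baseChange _ _ = x
    change G.d.baseChange _ w = _ at hw
    rw [← e2, hw, e1, add_sub_cancel_right]
  exact OrderHomClass.mono Cardinal.toENat (LinearMap.rank_le_of_injective _ hinj)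

end DM

/-! ### Graded modules: homogeneous components, graded free modules, products -/

/-- The candidate projections `c n` recover the coordinates of an element of the direct sum from its
image, which gives injectivity. -/
theorem isInternal_of_component {M : Type*} [AddCommGroup M] (piece : ℤ → AddSubgroup M)
    (c : ℤ → M →+ M) (hsame : ∀ n x, x ∈ piece n → c n x = x)
    (hne : ∀ n m x, x ∈ piece m → m ≠ n → c n x = 0) (hsup : ∀ x, x ∈ ⨆ n, piece n) :
    DirectSum.IsInternal piece := by
  constructor
  · rw [injective_iff_map_eq_zero]
    have key : ∀ (x : ⨁ n, piece n) (n : ℤ),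
        c n (DirectSum.coeAddMonoidHom piece x) = (x n : M) := by
      intro x n
      induction x using DirectSum.induction_on with
      | zero => simp
      | of i x =>
        rw [DirectSum.coeAddMonoidHom_of]
        by_cases h : i = n
        · subst h
          rw [DirectSum.of_eq_same, hsame _ _ x.2]
        · rw [DirectSum.of_eq_of_ne _ _ _ (Ne.symm h), hne _ _ _ x.2 h]
          rfl
      | add x y hx hy => rw [map_add, map_add, hx, hy]; rfl
    intro x hx
    ext n
    rw [← key, hx, map_zero]
    rfl
  · intro x
    have : (⨆ n, piece n) ≤ (DirectSum.coeAddMonoidHom piece).range :=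
      iSup_le fun n y hy => ⟨DirectSum.of (fun n => piece n) n ⟨y, hy⟩, by simp⟩
    exact this (hsup x)

section GrMod

variable {S : Type u} [CommRing S] {𝒜 : ℕ → AddSubgroup S}

namespace GrMod

variable (M N : GrMod 𝒜)

/-- The homogeneous component of degree `k` of an element. -/
def component (k : ℤ) : M →+ M :=
  letI := M.isInternal.chooseDecomposition
  (M.piece k).subtype.comp ((DFinsupp.evalAddMonoidHom (β := fun n => M.piece n) k).comp
    (DirectSum.decomposeAddEquiv M.piece).toAddMonoidHom)

variable {M N}

theorem component_mem (k : ℤ) (x : M) : M.component k x ∈ M.piece k :=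
  SetLike.coe_mem _

theorem component_of_mem {k : ℤ} {x : M} (hx : x ∈ M.piece k) : M.component k x = x :=
  letI := M.isInternal.chooseDecomposition
  DirectSum.decompose_of_mem_same M.piece hx

theorem component_of_mem_ne {k n : ℤ} {x : M} (hx : x ∈ M.piece n) (h : n ≠ k) :
    M.component k x = 0 :=
  letI := M.isInternal.chooseDecomposition
  DirectSum.decompose_of_mem_ne M.piece hx h

theorem homogeneous_induction {p : M → Prop} (zero : p 0)
    (homogeneous : ∀ n x, x ∈ M.piece n → p x) (add : ∀ x y, p x → p y → p (x + y)) (x : M) :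
    p x :=
  letI := M.isInternal.chooseDecomposition
  DirectSum.Decomposition.inductionOn M.piece zero (fun x => homogeneous _ _ x.2) add x

theorem map_component (f : M →ₗ[S] N) (s : ℤ) (hf : ∀ n x, x ∈ M.piece n → f x ∈ N.piece (n + s))
    (k : ℤ) (x : M) : f (M.component k x) = N.component (k + s) (f x) := by
  induction x using homogeneous_induction with
  | zero => simp
  | homogeneous n x hx =>
    by_cases h : n = k
    · subst h
      rw [component_of_mem hx, component_of_mem (hf _ _ hx)]
    · rw [component_of_mem_ne hx h, component_of_mem_ne (hf _ _ hx) (by omega), map_zero]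
  | add x y hx hy => simp only [map_add, hx, hy]

/-- The product of two graded modules. -/
abbrev prod (M N : GrMod 𝒜) : GrMod 𝒜 where
  carrier := M × N
  piece k := (M.piece k).prod (N.piece k)
  isInternal := by
    refine isInternal_of_component _ (fun k => (M.component k).prodMap (N.component k))
      (fun n x hx => ?_) (fun n m x hx h => ?_) (fun x => ?_)
    · exact Prod.ext (component_of_mem hx.1) (component_of_mem hx.2)
    · exact Prod.ext (component_of_mem_ne hx.1 h) (component_of_mem_ne hx.2 h)
    · have h1 : ∀ x : M, ((x, 0) : M × N) ∈ ⨆ k, (M.piece k).prod (N.piece k) := by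
        intro x
        induction x using homogeneous_induction with
        | zero => exact zero_mem _
        | homogeneous n x hx => exact AddSubgroup.mem_iSup_of_mem n ⟨hx, zero_mem _⟩
        | add x y hx hy => simpa using add_mem hx hy
      have h2 : ∀ x : N, ((0, x) : M × N) ∈ ⨆ k, (M.piece k).prod (N.piece k) := by
        intro x
        induction x using homogeneous_induction with
        | zero => exact zero_mem _
        | homogeneous n x hx => exact AddSubgroup.mem_iSup_of_mem n ⟨zero_mem _, hx⟩
        | add x y hx hy => simpa using add_mem hx hy
      simpa using add_mem (h1 x.1) (h2 x.2)
  smul_mem i n s m hs hm := ⟨M.smul_mem i n s _ hs hm.1, N.smul_mem i n s _ hs hm.2⟩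

theorem prod_component_snd (k : ℤ) (z : M.prod N) :
    ((M.prod N).component k z).2 = N.component k z.2 := by
  have := map_component (M := M.prod N) (N := N) (LinearMap.snd S M N) 0
    (fun n x hx => by rw [add_zero]; exact hx.2) k z
  rwa [add_zero] at this

end GrMod

/-! ### Graded free modules with a basis of prescribed degrees -/

variable (𝒜) in
/-- The grading of the base ring, extended by zero to negative degrees. -/
def intPiece (k : ℤ) : AddSubgroup S := if 0 ≤ k then 𝒜 k.toNat else ⊥

theorem intPiece_natCast (i : ℕ) : intPiece 𝒜 i = 𝒜 i := by simp [intPiece]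

theorem intPiece_of_neg {k : ℤ} (hk : k < 0) : intPiece 𝒜 k = ⊥ := if_neg (not_le.2 hk)

variable [GradedRing 𝒜]

theorem mul_mem_intPiece {i k : ℤ} {s t : S} (hs : s ∈ intPiece 𝒜 i) (ht : t ∈ intPiece 𝒜 k) :
    s * t ∈ intPiece 𝒜 (i + k) := by
  rcases lt_or_ge i 0 with hi | hi
  · rw [intPiece_of_neg hi, AddSubgroup.mem_bot] at hs
    rw [hs, zero_mul]
    exact zero_mem _
  rcases lt_or_ge k 0 with hk | hk
  · rw [intPiece_of_neg hk, AddSubgroup.mem_bot] at ht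
    rw [ht, mul_zero]
    exact zero_mem _
  lift i to ℕ using hi
  lift k to ℕ using hk
  rw [intPiece_natCast] at hs ht
  rw [← Nat.cast_add, intPiece_natCast]
  exact SetLike.mul_mem_graded hs ht

variable (𝒜) in
/-- The homogeneous component of integer degree `k` of an element of the base ring. -/
def intComponent (k : ℤ) : S →+ S := if 0 ≤ k then GradedRing.proj 𝒜 k.toNat else 0

theorem intComponent_of_mem {k : ℤ} {s : S} (hs : s ∈ intPiece 𝒜 k) :
    intComponent 𝒜 k s = s := by
  rcases lt_or_ge k 0 with hk | hk
  · rw [intPiece_of_neg hk, AddSubgroup.mem_bot] at hs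
    rw [hs, map_zero]
  · lift k to ℕ using hk
    rw [intPiece_natCast] at hs
    simpa [intComponent, GradedRing.proj_apply] using DirectSum.decompose_of_mem_same 𝒜 hs

theorem intComponent_of_mem_ne {k m : ℤ} {s : S} (hs : s ∈ intPiece 𝒜 m) (h : m ≠ k) :
    intComponent 𝒜 k s = 0 := by
  rcases lt_or_ge m 0 with hm | hm
  · rw [intPiece_of_neg hm, AddSubgroup.mem_bot] at hs
    rw [hs, map_zero]
  · lift m to ℕ using hm
    rw [intPiece_natCast] at hs
    rw [intComponent]
    split_ifs with hk
    · rw [GradedRing.proj_apply, DirectSum.decompose_of_mem_ne 𝒜 hs (by omega)]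
    · rfl

variable {ι : Type} (deg : ι → ℤ)

variable (𝒜) in
/-- The elements of degree `k` of the free module with a basis of prescribed degrees. -/
def degPiece (k : ℤ) : AddSubgroup (ι →₀ S) where
  carrier := {f | ∀ r, f r ∈ intPiece 𝒜 (k - deg r)}
  add_mem' := fun hf hg r => add_mem (hf r) (hg r)
  zero_mem' := fun _ => zero_mem _
  neg_mem' := fun hf r => neg_mem (hf r)

variable (𝒜) in
/-- The homogeneous components of elements of the free module with a basis of prescribed
degrees. -/
def degComponent (k : ℤ) : (ι →₀ S) →+ (ι →₀ S) :=
  Finsupp.liftAddHom fun r => (Finsupp.singleAddHom r).comp (intComponent 𝒜 (k - deg r))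

variable {deg}

omit [GradedRing 𝒜] in
theorem mem_degPiece {k : ℤ} {f : ι →₀ S} :
    f ∈ degPiece 𝒜 deg k ↔ ∀ r, f r ∈ intPiece 𝒜 (k - deg r) := Iff.rfl

theorem degComponent_apply (k : ℤ) (f : ι →₀ S) (r : ι) :
    degComponent 𝒜 deg k f r = intComponent 𝒜 (k - deg r) (f r) := by
  induction f using Finsupp.induction_linear with
  | zero => simp
  | add f g hf hg => rw [map_add, Finsupp.add_apply, hf, hg, Finsupp.add_apply, map_add]
  | single i s =>
    classical
    simp only [degComponent, Finsupp.liftAddHom_apply_single, AddMonoidHom.comp_apply,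
      Finsupp.singleAddHom_apply, Finsupp.single_apply]
    split_ifs with h
    · subst h; rfl
    · exact (map_zero _).symm

theorem degComponent_of_mem {k : ℤ} {f : ι →₀ S} (hf : f ∈ degPiece 𝒜 deg k) :
    degComponent 𝒜 deg k f = f := by
  ext r
  rw [degComponent_apply, intComponent_of_mem (hf r)]

theorem degComponent_of_mem_ne {k m : ℤ} {f : ι →₀ S} (hf : f ∈ degPiece 𝒜 deg m) (h : m ≠ k) :
    degComponent 𝒜 deg k f = 0 := by
  ext r
  rw [degComponent_apply, intComponent_of_mem_ne (hf r) (by omega), Finsupp.zero_apply]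

omit [GradedRing 𝒜] in
theorem single_mem_degPiece {n : ℤ} {s : S} (hs : s ∈ intPiece 𝒜 n) (i : ι) :
    Finsupp.single i s ∈ degPiece 𝒜 deg (n + deg i) := by
  intro r
  classical
  rw [Finsupp.single_apply]
  split_ifs with h
  · subst h; rw [add_sub_cancel_right]; exact hs
  · exact zero_mem _

theorem single_one_mem_degPiece (i : ι) :
    Finsupp.single i (1 : S) ∈ degPiece 𝒜 deg (deg i) := by
  have := single_mem_degPiece (deg := deg) (n := 0) (s := (1 : S))
    (by rw [← Nat.cast_zero, intPiece_natCast]; exact SetLike.one_mem_graded 𝒜) i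
  rwa [zero_add] at this

theorem mem_iSup_degPiece (f : ι →₀ S) : f ∈ ⨆ k, degPiece 𝒜 deg k := by
  induction f using Finsupp.induction_linear with
  | zero => exact zero_mem _
  | add f g hf hg => exact add_mem hf hg
  | single i s =>
    induction s using DirectSum.Decomposition.inductionOn 𝒜 with
    | zero => rw [Finsupp.single_zero]; exact zero_mem _
    | @homogeneous n s =>
      exact AddSubgroup.mem_iSup_of_mem _
        (single_mem_degPiece (n := n) (by rw [intPiece_natCast]; exact s.2) i)
    | add s t hs ht => rw [Finsupp.single_add]; exact add_mem hs ht

variable (𝒜 deg) in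
/-- The graded free module with a basis of elements of prescribed degrees. -/
abbrev GrMod.ofDegrees : GrMod 𝒜 where
  carrier := ι →₀ S
  piece := degPiece 𝒜 deg
  isInternal := isInternal_of_component _ (degComponent 𝒜 deg)
    (fun _ _ hx => degComponent_of_mem hx) (fun _ _ _ hx h => degComponent_of_mem_ne hx h)
    mem_iSup_degPiece
  smul_mem i n s m hs hm r := by
    rw [add_sub_assoc]
    exact mul_mem_intPiece (by rwa [intPiece_natCast]) (hm r)

namespace GrMod

theorem component_ofDegrees (k : ℤ) (f : ι →₀ S) :
    (ofDegrees 𝒜 deg).component k f = degComponent 𝒜 deg k f := by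
  induction f using homogeneous_induction (M := ofDegrees 𝒜 deg) with
  | zero => exact (map_zero _).trans (map_zero _).symm
  | homogeneous n x hx =>
    by_cases h : n = k
    · subst h
      rw [component_of_mem hx, degComponent_of_mem hx]
    · rw [component_of_mem_ne hx h, degComponent_of_mem_ne hx h]
  | add x y hx hy => exact (map_add _ x y).trans ((congrArg₂ _ hx hy).trans (map_add _ x y).symm)

omit [GradedRing 𝒜] in
theorem smul_mem_of_mem_intPiece {M : GrMod 𝒜} {i n : ℤ} {s : S} {m : M}
    (hs : s ∈ intPiece 𝒜 i) (hm : m ∈ M.piece n) : s • m ∈ M.piece (i + n) := by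
  rcases lt_or_ge i 0 with hi | hi
  · rw [intPiece_of_neg hi, AddSubgroup.mem_bot] at hs
    rw [hs, zero_smul]
    exact zero_mem _
  lift i to ℕ using hi
  rw [intPiece_natCast] at hs
  exact M.smul_mem i n s m hs hm

omit [GradedRing 𝒜] in
theorem linearCombination_mem {M : GrMod 𝒜} {v : ι → M} {s : ℤ}
    (hv : ∀ r, v r ∈ M.piece (deg r + s)) {k : ℤ} {f : ι →₀ S} (hf : f ∈ degPiece 𝒜 deg k) :
    Finsupp.linearCombination S v f ∈ M.piece (k + s) := by
  rw [Finsupp.linearCombination_apply]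
  refine sum_mem fun r _ => ?_
  have := smul_mem_of_mem_intPiece (hf r) (hv r)
  rwa [← add_assoc, sub_add_cancel] at this

/-- The degree `n` component of the coordinate vector also represents `x`, so by uniqueness of
coordinates it is the whole vector. -/
theorem repr_mem_degPiece {M : GrMod 𝒜} (b : Module.Basis ι S M)
    (hb : ∀ r, b r ∈ M.piece (deg r)) {n : ℤ} {x : M} (hx : x ∈ M.piece n) :
    b.repr x ∈ degPiece 𝒜 deg n := by
  have h := map_component (M := ofDegrees 𝒜 deg) (N := M)
    (Finsupp.linearCombination S b) 0
    (fun k f hf => linearCombination_mem (by simpa using hb) hf) n (b.repr x)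
  rw [add_zero, b.linearCombination_repr, component_of_mem hx] at h
  have h' := congrArg b.repr h
  rw [b.repr_linearCombination] at h'
  rw [← h']
  exact component_mem (M := ofDegrees 𝒜 deg) n (b.repr x)

end GrMod

/-! ### Reduction modulo the homogeneous maximal ideal -/

variable [IsLocalRing (𝒜 0)]

theorem intPiece_le_homMaxIdeal {k : ℤ} (hk : k ≠ 0) {s : S} (hs : s ∈ intPiece 𝒜 k) :
    s ∈ homMaxIdeal 𝒜 := by
  rcases lt_or_ge k 0 with hk' | hk'
  · rw [intPiece_of_neg hk', AddSubgroup.mem_bot] at hs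
    rw [hs]
    exact zero_mem _
  lift k to ℕ using hk'
  rw [intPiece_natCast] at hs
  rw [homMaxIdeal, Ideal.mem_comap]
  have : GradedRing.projZeroRingHom' 𝒜 s = 0 := by
    ext
    exact DirectSum.decompose_of_mem_ne 𝒜 hs (by exact_mod_cast hk)
  rw [this]
  exact zero_mem _

theorem homMaxIdeal_ne_top : homMaxIdeal 𝒜 ≠ ⊤ :=
  Ideal.comap_ne_top _ (IsLocalRing.maximalIdeal.isMaximal _).ne_top

instance : Nontrivial (ResField 𝒜) := Ideal.Quotient.nontrivial_iff.2 homMaxIdeal_ne_top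

/-- For `S₀` a field, the homogeneous maximal ideal is zero in degree zero. -/
theorem eq_zero_of_mem_homMaxIdeal (h : IsField (𝒜 0)) {s : S} (hs : s ∈ intPiece 𝒜 0)
    (hm : s ∈ homMaxIdeal 𝒜) : s = 0 := by
  rw [← Nat.cast_zero, intPiece_natCast] at hs
  rw [homMaxIdeal, Ideal.mem_comap, IsLocalRing.isField_iff_maximalIdeal_eq.1 h,
    Ideal.mem_bot] at hm
  have := congrArg Subtype.val hm
  rw [← DirectSum.decompose_of_mem_same 𝒜 hs]
  exact this

/-- Turns minimality into a condition on matrix entries. -/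
theorem baseChange_eq_zero_iff {M N : Type*} [AddCommGroup M] [Module S M] [AddCommGroup N]
    [Module S N] {κ : Type*} (b : Module.Basis κ S N) (I : Ideal S) (f : M →ₗ[S] N) :
    f.baseChange (S ⧸ I) = 0 ↔ ∀ x r, b.repr (f x) r ∈ I := by
  have key : ∀ y r,
      (b.baseChange (S ⧸ I)).repr (1 ⊗ₜ[S] y) r = Ideal.Quotient.mk I (b.repr y r) := by
    intro y r
    rw [Module.Basis.baseChange_repr_tmul, Algebra.smul_def, mul_one]
    rfl
  constructor
  · intro h x r
    have := LinearMap.congr_fun h (1 ⊗ₜ[S] x)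
    rw [LinearMap.baseChange_tmul, LinearMap.zero_apply] at this
    rw [← Ideal.Quotient.eq_zero_iff_mem, ← key, this, map_zero, Finsupp.zero_apply]
  · intro h
    refine LinearMap.ext fun z => ?_
    induction z using TensorProduct.induction_on with
    | zero => simp
    | add x y hx hy => rw [map_add, hx, hy, map_add]
    | tmul s x =>
      have hz : (1 : S ⧸ I) ⊗ₜ[S] f x = 0 := by
        apply (b.baseChange (S ⧸ I)).repr.injective
        ext r
        rw [key, map_zero, Finsupp.zero_apply, Ideal.Quotient.eq_zero_iff_mem]
        exact h x r
      have : s ⊗ₜ[S] f x = s • ((1 : S ⧸ I) ⊗ₜ[S] f x) := by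
        rw [TensorProduct.smul_tmul', smul_eq_mul, mul_one]
      rw [LinearMap.baseChange_tmul, this, hz, smul_zero, LinearMap.zero_apply]

end GrMod

/-! ### The free flag resolution built from a resolution of the homology -/

namespace FlagRes

variable {S : Type u} [CommRing S] {𝒜 : ℕ → AddSubgroup S} [GradedRing 𝒜] [IsLocalRing (𝒜 0)]
  {a : ℤ} {D : DM 𝒜 a} (P : MinFreeRes D.homology) {n : ℕ → ℕ}
  (b : ∀ i, Module.Basis (Fin (n i)) S (P.F i))

/-- The index set of a basis of `⨁ F i`. -/
abbrev Idx (n : ℕ → ℕ) : Type := Σ i : ℕ, Fin (n i)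

variable (S n) in
/-- The part of `⨁ F i` spanned by the basis elements of level less than `k`. -/
abbrev below (k : ℕ) : Submodule S (Idx n →₀ S) := Finsupp.supported S S {s | s.1 < k}

omit [GradedRing 𝒜] [IsLocalRing (𝒜 0)] in
theorem mem_below {k : ℕ} {f : Idx n →₀ S} : f ∈ below S n k ↔ ∀ s, k ≤ s.1 → f s = 0 := by
  simp only [below, Finsupp.mem_supported', Set.mem_ofPred_eq, not_lt]

theorem below_mono {k m : ℕ} (h : k ≤ m) : below S n k ≤ below S n m :=
  Finsupp.supported_mono fun _ hs => lt_of_lt_of_le hs h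

/-- The projection of `⨁ F i` to `F i`. -/
def proj (i : ℕ) : (Idx n →₀ S) →ₗ[S] P.F i :=
  (b i).repr.symm.toLinearMap ∘ₗ
    Finsupp.lcomapDomain (Sigma.mk (β := fun j => Fin (n j)) i) sigma_mk_injective

theorem repr_proj (i : ℕ) (f : Idx n →₀ S) (r : Fin (n i)) :
    (b i).repr (proj P b i f) r = f ⟨i, r⟩ := by
  rw [proj, LinearMap.comp_apply, LinearEquiv.coe_coe, LinearEquiv.apply_symm_apply]
  rfl

/-- The inclusion of `F i` into `⨁ F i`. -/
def incl (i : ℕ) : P.F i →ₗ[S] (Idx n →₀ S) :=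
  (b i).constr S fun r => Finsupp.single ⟨i, r⟩ 1

theorem incl_apply_same (i : ℕ) (p : P.F i) (r : Fin (n i)) :
    incl P b i p ⟨i, r⟩ = (b i).repr p r := by
  have : Finsupp.lapply ⟨i, r⟩ ∘ₗ incl P b i = Finsupp.lapply r ∘ₗ (b i).repr.toLinearMap := by
    refine (b i).ext fun s => ?_
    classical
    simp [incl, Finsupp.single_apply, Finsupp.lapply_apply]
  exact LinearMap.congr_fun this p

theorem incl_apply_ne {i : ℕ} (p : P.F i) {s : Idx n} (h : s.1 ≠ i) : incl P b i p s = 0 := by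
  have : Finsupp.lapply s ∘ₗ incl P b i = 0 := by
    refine (b i).ext fun r => ?_
    rw [LinearMap.comp_apply, incl, Module.Basis.constr_basis, Finsupp.lapply_apply,
      Finsupp.single_eq_of_ne (fun h' => h (congrArg Sigma.fst h')), LinearMap.zero_apply]
  exact LinearMap.congr_fun this p

theorem incl_mem_below (i : ℕ) (p : P.F i) : incl P b i p ∈ below S n (i + 1) :=
  mem_below.2 fun s hs => incl_apply_ne P b p (by omega)

theorem proj_incl (i : ℕ) (p : P.F i) : proj P b i (incl P b i p) = p := by
  apply (b i).repr.injective
  ext r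
  rw [repr_proj, incl_apply_same]

theorem proj_eq_zero_of_mem_below {i : ℕ} {f : Idx n →₀ S} (hf : f ∈ below S n i) :
    proj P b i f = 0 := by
  apply (b i).repr.injective
  ext r
  rw [repr_proj, mem_below.1 hf _ le_rfl, map_zero, Finsupp.zero_apply]

theorem sub_incl_proj_mem_below {i : ℕ} {f : Idx n →₀ S} (hf : f ∈ below S n (i + 1)) :
    f - incl P b i (proj P b i f) ∈ below S n i := by
  rw [mem_below]
  rintro ⟨j, r⟩ hs
  rw [Finsupp.sub_apply]
  by_cases h : j = i
  · subst h
    rw [incl_apply_same, repr_proj, sub_self]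
  · rw [incl_apply_ne P b _ h, sub_zero]
    exact mem_below.1 hf _ (by change i + 1 ≤ j; change i ≤ j at hs; omega)

/-- The endomorphism `(x, f) ↦ (d x, 0) + ∑ f r • Λ r` of `D × ⨁ F i`. -/
def totalD (D : DM 𝒜 a) (Λ : Idx n → D × (Idx n →₀ S)) :
    (D × (Idx n →₀ S)) →ₗ[S] (D × (Idx n →₀ S)) :=
  (LinearMap.inl S D (Idx n →₀ S) ∘ₗ D.d).coprod (Finsupp.linearCombination S Λ)

omit [GradedRing 𝒜] [IsLocalRing (𝒜 0)] in
theorem totalD_apply (Λ : Idx n → D × (Idx n →₀ S)) (z : D × (Idx n →₀ S)) :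
    totalD D Λ z = (D.d z.1, 0) + Finsupp.linearCombination S Λ z.2 := rfl

omit [GradedRing 𝒜] [IsLocalRing (𝒜 0)] in
theorem totalD_congr {Λ Λ' : Idx n → D × (Idx n →₀ S)} {k : ℕ}
    (h : ∀ r : Idx n, r.1 < k → Λ' r = Λ r) {z : D × (Idx n →₀ S)} (hz : z.2 ∈ below S n k) :
    totalD D Λ' z = totalD D Λ z := by
  rw [totalD_apply, totalD_apply, Finsupp.linearCombination_apply, Finsupp.linearCombination_apply]
  congr 1
  refine Finset.sum_congr rfl fun r hr => ?_
  beta_reduce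
  rw [h r ((Finsupp.mem_supported S z.2).1 hz hr)]

/-- The pairs `(z, p)` for which the class of the cycle `z` in the homology of
`D ⊕ F 0 ⊕ ⋯ ⊕ F (k-1)` is the image of `p ∈ F k`. -/
def rep : (k : ℕ) → Submodule S ((D × (Idx n →₀ S)) × P.F k)
  | 0 =>
    { carrier := {w | ∃ y : LinearMap.ker D.d, (y : D) = w.1.1 ∧
        (Submodule.Quotient.mk y : Hlgy D.d) = P.ε w.2}
      add_mem' := by
        rintro w w' ⟨y, hy, hyw⟩ ⟨y', hy', hyw'⟩
        refine ⟨y + y', by simp [hy, hy'], ?_⟩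
        rw [Submodule.Quotient.mk_add, hyw, hyw']
        exact (map_add P.ε _ _).symm
      zero_mem' := ⟨0, rfl, (map_zero P.ε).symm⟩
      smul_mem' := by
        rintro c w ⟨y, hy, hyw⟩
        refine ⟨c • y, by simp [hy], ?_⟩
        rw [Submodule.Quotient.mk_smul, hyw]
        exact (map_smul P.ε _ _).symm }
  | k + 1 => LinearMap.ker
      (proj P b k ∘ₗ LinearMap.snd S D (Idx n →₀ S) ∘ₗ LinearMap.fst S _ (P.F (k + 1)) -
        P.δ k ∘ₗ LinearMap.snd S _ (P.F (k + 1)))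

theorem mem_rep_zero {z : D × (Idx n →₀ S)} {p : P.F 0} : (z, p) ∈ rep P b 0 ↔
    ∃ y : LinearMap.ker D.d, (y : D) = z.1 ∧ (Submodule.Quotient.mk y : Hlgy D.d) = P.ε p :=
  Iff.rfl

theorem mem_rep_succ {k : ℕ} {z : D × (Idx n →₀ S)} {p : P.F (k + 1)} :
    (z, p) ∈ rep P b (k + 1) ↔ proj P b k z.2 = P.δ k p := by
  rw [rep, LinearMap.mem_ker, LinearMap.sub_apply, sub_eq_zero]
  rfl

/-- Exactness of the resolution enters here: `rep` determines `p` from `z` precisely up to the image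
of `δ k`. -/
theorem zero_mem_rep_iff {k : ℕ} {p : P.F k} :
    ((0 : D × (Idx n →₀ S)), p) ∈ rep P b k ↔ ∃ q, P.δ k q = p := by
  cases k with
  | zero =>
    rw [mem_rep_zero, ← Set.mem_range, ← P.exact_zero p]
    constructor
    · rintro ⟨y, hy, hyp⟩
      have : y = 0 := Subtype.ext hy
      rw [← hyp, this]
      rfl
    · intro h
      exact ⟨0, rfl, h.symm⟩
  | succ k =>
    rw [mem_rep_succ, ← Set.mem_range, ← P.exact_succ k p]
    simp [eq_comm]

/-- The conditions that the value of the differential on the basis element `r` has to satisfy. -/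
def IsGood (Λ : Idx n → D × (Idx n →₀ S)) (r : Idx n) : Prop :=
  (Λ r).2 ∈ below S n r.1 ∧ totalD D Λ (Λ r) = 0 ∧ (Λ r, b r.1 r.2) ∈ rep P b r.1

/-- The homology of `D ⊕ F 0 ⊕ ⋯ ⊕ F (k-1)` is the cokernel of `δ k`. -/
structure ExactAt (Λ : Idx n → D × (Idx n →₀ S)) (k : ℕ) : Prop where
  exists_cycle : ∀ p : P.F k, ∃ z, z.2 ∈ below S n k ∧ totalD D Λ z = 0 ∧ (z, p) ∈ rep P b k
  exists_rep : ∀ z, z.2 ∈ below S n k → totalD D Λ z = 0 → ∃ p : P.F k, (z, p) ∈ rep P b k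
  exists_bound : ∀ z, z.2 ∈ below S n k → totalD D Λ z = 0 → (z, 0) ∈ rep P b k →
    ∃ w, w.2 ∈ below S n k ∧ totalD D Λ w = z
  bound_rep : ∀ w, w.2 ∈ below S n k → (totalD D Λ w, 0) ∈ rep P b k

variable {P b}

theorem IsGood.congr {Λ Λ' : Idx n → D × (Idx n →₀ S)} {r : Idx n} (hr : IsGood P b Λ r)
    (h : ∀ s : Idx n, s.1 ≤ r.1 → Λ' s = Λ s) : IsGood P b Λ' r := by
  rw [IsGood, h r le_rfl, totalD_congr (fun s hs => h s hs.le) hr.1]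
  exact hr

theorem ExactAt.congr {Λ Λ' : Idx n → D × (Idx n →₀ S)} {k : ℕ} (hk : ExactAt P b Λ k)
    (h : ∀ s : Idx n, s.1 < k → Λ' s = Λ s) : ExactAt P b Λ' k where
  exists_cycle p := by
    obtain ⟨z, hz, h1, h2⟩ := hk.exists_cycle p
    exact ⟨z, hz, by rwa [totalD_congr h hz], h2⟩
  exists_rep z hz h1 := hk.exists_rep z hz (by rwa [totalD_congr h hz] at h1)
  exists_bound z hz h1 h2 := by
    obtain ⟨w, hw, hwz⟩ := hk.exists_bound z hz (by rwa [totalD_congr h hz] at h1) h2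
    exact ⟨w, hw, by rwa [totalD_congr h hw]⟩
  bound_rep w hw := by
    rw [totalD_congr h hw]
    exact hk.bound_rep w hw

omit [GradedRing 𝒜] [IsLocalRing (𝒜 0)] in
theorem snd_totalD_mem_below {Λ : Idx n → D × (Idx n →₀ S)} {k : ℕ}
    (h : ∀ r : Idx n, r.1 < k + 1 → (Λ r).2 ∈ below S n r.1) {z : D × (Idx n →₀ S)}
    (hz : z.2 ∈ below S n (k + 1)) : (totalD D Λ z).2 ∈ below S n k := by
  rw [totalD_apply, Prod.snd_add, zero_add, Finsupp.linearCombination_apply, Finsupp.sum,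
    Prod.snd_sum]
  refine sum_mem fun r hr => Submodule.smul_mem _ _ ?_
  have hr' : r.1 < k + 1 := (Finsupp.mem_supported S z.2).1 hz hr
  exact below_mono (Nat.lt_succ_iff.1 hr') (h r hr')

omit [GradedRing 𝒜] [IsLocalRing (𝒜 0)] in
theorem totalD_totalD {Λ : Idx n → D × (Idx n →₀ S)} {k : ℕ}
    (h : ∀ r : Idx n, r.1 < k → totalD D Λ (Λ r) = 0) {z : D × (Idx n →₀ S)}
    (hz : z.2 ∈ below S n k) : totalD D Λ (totalD D Λ z) = 0 := by
  have h0 : totalD D Λ (D.d z.1, 0) = 0 := by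
    rw [totalD_apply, D.d_d, map_zero]
    exact add_zero _
  rw [totalD_apply Λ z, map_add, h0, zero_add, Finsupp.linearCombination_apply, Finsupp.sum,
    map_sum]
  apply Finset.sum_eq_zero
  intro r hr
  rw [map_smul, h r ((Finsupp.mem_supported S z.2).1 hz hr), smul_zero]

/-- The three conditions in `IsGood` are linear, so they pass from the basis of `F k` to all of `F
k`. -/
theorem totalD_incl {Λ : Idx n → D × (Idx n →₀ S)} {k : ℕ}
    (h : ∀ r : Idx n, r.1 = k → IsGood P b Λ r) (p : P.F k) :
    (totalD D Λ (0, incl P b k p)).2 ∈ below S n k ∧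
      totalD D Λ (totalD D Λ (0, incl P b k p)) = 0 ∧
      (totalD D Λ (0, incl P b k p), p) ∈ rep P b k := by
  set L : P.F k →ₗ[S] (D × (Idx n →₀ S)) :=
    totalD D Λ ∘ₗ LinearMap.inr S D (Idx n →₀ S) ∘ₗ incl P b k with hL
  have hLb : ∀ r, L (b k r) = Λ ⟨k, r⟩ := by
    intro r
    simp [hL, incl, totalD_apply]
  let W : Submodule S (P.F k) := (below S n k).comap (LinearMap.snd S D (Idx n →₀ S) ∘ₗ L) ⊓
    LinearMap.ker (totalD D Λ ∘ₗ L) ⊓ (rep P b k).comap (L.prod LinearMap.id)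
  have hW : W = ⊤ := by
    rw [eq_top_iff, ← (b k).span_eq, Submodule.span_le]
    rintro _ ⟨r, rfl⟩
    obtain ⟨h1, h2, h3⟩ := h ⟨k, r⟩ rfl
    refine ⟨⟨?_, ?_⟩, ?_⟩
    · change (L (b k r)).2 ∈ below S n k
      rwa [hLb]
    · change totalD D Λ (L (b k r)) = 0
      rwa [hLb]
    · change (L (b k r), b k r) ∈ rep P b k
      rwa [hLb]
  have hp : p ∈ W := hW ▸ Submodule.mem_top
  exact ⟨hp.1.1, hp.1.2, hp.2⟩

theorem exactAt_zero (Λ : Idx n → D × (Idx n →₀ S)) : ExactAt P b Λ 0 := by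
  have h0 : ∀ f : Idx n →₀ S, f ∈ below S n 0 → f = 0 := fun f hf =>
    Finsupp.ext fun s => mem_below.1 hf s (Nat.zero_le _)
  refine ⟨fun p => ?_, fun z hz hd => ?_, fun z hz hd hr => ?_, fun w hw => ?_⟩
  · obtain ⟨y, hy⟩ := Submodule.Quotient.mk_surjective _ (P.ε p : Hlgy D.d)
    refine ⟨(y, 0), zero_mem _, ?_, y, rfl, hy⟩
    rw [totalD_apply, LinearMap.mem_ker.1 y.2, map_zero]
    exact add_zero _
  · obtain ⟨x, f⟩ := z
    obtain rfl := h0 f hz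
    rw [totalD_apply, map_zero, add_zero] at hd
    obtain ⟨p, hp⟩ := P.ε_surjective (Submodule.Quotient.mk ⟨x, congrArg Prod.fst hd⟩ : Hlgy D.d)
    exact ⟨p, ⟨x, congrArg Prod.fst hd⟩, rfl, hp.symm⟩
  · obtain ⟨x, f⟩ := z
    obtain rfl := h0 f hz
    obtain ⟨y, rfl, hy⟩ := hr
    have hy' : (Submodule.Quotient.mk y : Hlgy D.d) = 0 := hy.trans (map_zero P.ε)
    rw [Submodule.Quotient.mk_eq_zero] at hy'
    obtain ⟨w, hw⟩ := hy'
    refine ⟨(w, 0), zero_mem _, ?_⟩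
    rw [totalD_apply, map_zero, add_zero]
    exact Prod.ext hw rfl
  · obtain ⟨x, f⟩ := w
    obtain rfl := h0 f hw
    refine ⟨⟨D.d x, D.d_d x⟩, by simp [totalD_apply], ?_⟩
    refine Eq.trans ?_ (map_zero P.ε).symm
    exact (Submodule.Quotient.mk_eq_zero _).2 ⟨x, rfl⟩

/-- Attaching `F k` kills the homology of the previous stage, since `F k` surjects onto it. The new
homology is the kernel of that surjection, namely the image of `δ k`, read off from the `F
k`-component of a cycle. -/
theorem ExactAt.succ {Λ : Idx n → D × (Idx n →₀ S)} {k : ℕ} (hk : ExactAt P b Λ k)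
    (h : ∀ r : Idx n, r.1 < k + 1 → IsGood P b Λ r) : ExactAt P b Λ (k + 1) := by
  have hL := totalD_incl (P := P) (b := b) (Λ := Λ) (k := k) (fun r hr => h r (by omega))
  have hsplit : ∀ z : D × (Idx n →₀ S),
      z = (z.1, z.2 - incl P b k (proj P b k z.2)) + (0, incl P b k (proj P b k z.2)) := by
    intro z
    ext <;> simp
  refine ⟨fun q => ?_, fun z hz hd => ?_, fun z hz hd hr => ?_, fun w hw => ?_⟩
  -- The element `δ k q` maps to the zero class, so its differential is already the boundary of some
  -- `c` below level `k`; subtracting `c` gives a cycle with `F k`-component `δ k q`.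
  · obtain ⟨h1, h2, h3⟩ := hL (P.δ k q)
    have h0 : ((0 : D × (Idx n →₀ S)), P.δ k q) ∈ rep P b k := (zero_mem_rep_iff P b).2 ⟨q, rfl⟩
    obtain ⟨c, hc, hcd⟩ := hk.exists_bound _ h1 h2 (by simpa using sub_mem h3 h0)
    refine ⟨(0, incl P b k (P.δ k q)) - c,
      sub_mem (incl_mem_below P b k _) (below_mono k.le_succ hc), ?_, ?_⟩
    · rw [map_sub, hcd, sub_self]
    · rw [mem_rep_succ, Prod.snd_sub, map_sub, proj_incl, proj_eq_zero_of_mem_below P b hc,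
        sub_zero]
  -- For a cycle, the differential of its `F k`-component cancels a boundary from below, so that
  -- component represents the zero class.
  · have hc := sub_incl_proj_mem_below P b hz
    obtain ⟨h1, h2, h3⟩ := hL (proj P b k z.2)
    have h4 := hk.bound_rep (z.1, z.2 - incl P b k (proj P b k z.2)) hc
    have h5 := add_mem h4 h3
    rw [Prod.mk_add_mk, zero_add, ← map_add, ← hsplit, hd] at h5
    obtain ⟨q, hq⟩ := (zero_mem_rep_iff P b).1 h5
    exact ⟨q, (mem_rep_succ P b).2 hq.symm⟩
  -- With no `F k`-component, `z` is a cycle of the previous stage; its class comes from some `p ∈ F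
  -- k`, and subtracting the differential of `p` leaves an old boundary.
  · rw [mem_rep_succ, map_zero] at hr
    have hz' := sub_incl_proj_mem_below P b hz
    rw [hr, map_zero, sub_zero] at hz'
    obtain ⟨p, hp⟩ := hk.exists_rep z hz' hd
    obtain ⟨h1, h2, h3⟩ := hL p
    obtain ⟨c, hc, hcd⟩ := hk.exists_bound (z - totalD D Λ (0, incl P b k p)) (sub_mem hz' h1)
      (by rw [map_sub, hd, h2, sub_zero]) (by simpa using sub_mem hp h3)
    refine ⟨c + (0, incl P b k p), add_mem (below_mono k.le_succ hc) (incl_mem_below P b k p), ?_⟩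
    rw [map_add, hcd, sub_add_cancel]
  · rw [mem_rep_succ, map_zero]
    exact proj_eq_zero_of_mem_below P b (snd_totalD_mem_below (fun r hr => (h r hr).1) hw)

/-! #### Gradings -/

variable (n a) in
/-- The degrees of the basis elements of `⨁ F i` in the mapping cone. -/
def coneDeg (dg : ℕ → ℤ) (r : Idx n) : ℤ := dg r.1 - (r.1 + 1) * a

variable (D n) in
/-- The graded module `D ⊕ ⨁ F i`. -/
abbrev cone (dg : ℕ → ℤ) : GrMod 𝒜 := D.toGrMod.prod (GrMod.ofDegrees 𝒜 (coneDeg a n dg))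

omit [IsLocalRing (𝒜 0)] in
theorem totalD_mem {dg : ℕ → ℤ} {Λ : Idx n → D × (Idx n →₀ S)}
    (hΛ : ∀ r, Λ r ∈ (cone D n dg).piece (coneDeg a n dg r + a)) {k : ℤ} {z : D × (Idx n →₀ S)}
    (hz : z ∈ (cone D n dg).piece k) : totalD D Λ z ∈ (cone D n dg).piece (k + a) := by
  rw [totalD_apply]
  refine add_mem ⟨D.d_mem _ _ hz.1, zero_mem _⟩ ?_
  exact GrMod.linearCombination_mem (M := cone D n dg) hΛ hz.2

theorem proj_mem {dg : ℕ → ℤ} (hb : ∀ i r, b i r ∈ (P.F i).piece (dg i)) (i : ℕ) (k : ℤ)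
    (f : Idx n →₀ S) (hf : f ∈ degPiece 𝒜 (coneDeg a n dg) k) :
    proj P b i f ∈ (P.F i).piece (k + (i + 1) * a) := by
  rw [← (b i).linearCombination_repr (proj P b i f), ← add_zero (k + _)]
  refine GrMod.linearCombination_mem (deg := fun _ => dg i) (fun r => by simpa using hb i r) ?_
  intro r
  rw [repr_proj]
  have e : k + (i + 1) * a - dg i = k - coneDeg a n dg ⟨i, r⟩ := by rw [coneDeg]; ring
  rw [e]
  exact hf ⟨i, r⟩

/-- Both `totalD` and `proj` are homogeneous, so beyond `k = 0`, where `ε` is graded, any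
representing cycle may be replaced by its component of the right degree. -/
theorem exists_homogeneous_cycle {dg : ℕ → ℤ} (hb : ∀ i r, b i r ∈ (P.F i).piece (dg i))
    {Λ : Idx n → D × (Idx n →₀ S)}
    (hΛ : ∀ r, Λ r ∈ (cone D n dg).piece (coneDeg a n dg r + a)) {k : ℕ} (hk : ExactAt P b Λ k)
    (r : Fin (n k)) : ∃ z ∈ (cone D n dg).piece (coneDeg a n dg ⟨k, r⟩ + a),
      z.2 ∈ below S n k ∧ totalD D Λ z = 0 ∧ (z, b k r) ∈ rep P b k := by
  cases k with
  | zero =>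
    obtain ⟨y, hy, hyp⟩ := (D.mem_homologyPiece _ _).1 (P.ε_graded _ _ (hb 0 r))
    refine ⟨(y, 0), ⟨?_, zero_mem _⟩, zero_mem _, ?_, y, rfl, hyp⟩
    · simpa [coneDeg] using hy
    · rw [totalD_apply, LinearMap.mem_ker.1 y.2, map_zero]
      exact add_zero _
  | succ k =>
    obtain ⟨z, hz, hd, hr⟩ := hk.exists_cycle (b (k + 1) r)
    set m := coneDeg a n dg ⟨k + 1, r⟩ + a with hm
    have h2 : ((cone D n dg).component m z).2 = degComponent 𝒜 (coneDeg a n dg) m z.2 := by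
      rw [GrMod.prod_component_snd, GrMod.component_ofDegrees]
    refine ⟨(cone D n dg).component m z, GrMod.component_mem _ _, ?_, ?_, ?_⟩
    · rw [h2, mem_below]
      intro s hs
      rw [degComponent_apply, mem_below.1 hz s hs, map_zero]
    · have := GrMod.map_component (M := cone D n dg) (N := cone D n dg) (totalD D Λ) a
        (fun _ _ hx => totalD_mem hΛ hx) m z
      rw [this, hd, map_zero]
    · rw [mem_rep_succ] at hr ⊢
      rw [h2, ← GrMod.component_ofDegrees]
      have := GrMod.map_component (M := GrMod.ofDegrees 𝒜 (coneDeg a n dg)) (N := P.F k)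
        (proj P b k) ((k + 1) * a) (fun i f hf => proj_mem hb k i f hf) m z.2
      rw [this, hr]
      apply GrMod.component_of_mem
      have e : m + (k + 1) * a = dg (k + 1) := by
        rw [hm, coneDeg]; push_cast; ring
      rw [e]
      exact P.δ_graded k _ _ (hb (k + 1) r)

variable (P b) in
/-- There is a family `Λ` of values on the basis elements that makes `D ⊕ ⨁ F i` an acyclic
differential module. -/
theorem exists_good {dg : ℕ → ℤ} (hb : ∀ i r, b i r ∈ (P.F i).piece (dg i)) :
    ∃ Λ : Idx n → D × (Idx n →₀ S),
      (∀ r, Λ r ∈ (cone D n dg).piece (coneDeg a n dg r + a)) ∧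
      (∀ r, IsGood P b Λ r) ∧ ∀ k, ExactAt P b Λ k := by
  obtain ⟨Λ, hΛ⟩ := exists_of_level_step
    (X := fun r : Idx n => (cone D n dg).piece (coneDeg a n dg r + a)) Sigma.fst
    (fun k Λ => (∀ r : Idx n, r.1 < k → IsGood P b (fun r => (Λ r : D × (Idx n →₀ S))) r) ∧
      ExactAt P b (fun r => (Λ r : D × (Idx n →₀ S))) k)
    (fun k f g hfg hf =>
      ⟨fun r hr => (hf.1 r hr).congr fun s hs => by rw [hfg s (lt_of_le_of_lt hs hr)],
        hf.2.congr fun s hs => by rw [hfg s hs]⟩)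
    (fun f => ⟨fun r hr => absurd hr (Nat.not_lt_zero _), exactAt_zero _⟩)
    (by
      rintro k f ⟨hf, hk⟩
      choose z hz1 hz2 using exists_homogeneous_cycle hb (fun r => (f r).2) hk
      let g : ∀ r : Idx n, (cone D n dg).piece (coneDeg a n dg r + a) := fun r =>
        if h : r.1 = k then ⟨z (Fin.cast (by rw [h]) r.2), by
          obtain ⟨i, r⟩ := r
          subst h
          exact hz1 r⟩ else f r
      have hgf : ∀ r : Idx n, r.1 < k → g r = f r := fun r hr => dif_neg hr.ne
      have hg : ∀ r : Idx n, r.1 < k + 1 →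
          IsGood P b (fun r => (g r : D × (Idx n →₀ S))) r := by
        rintro ⟨i, r⟩ hr
        by_cases h : i = k
        · subst h
          have hgr : (g ⟨i, r⟩ : D × (Idx n →₀ S)) = z r :=
            congrArg Subtype.val (dif_pos (c := i = i) rfl)
          obtain ⟨h1, h2, h3⟩ := hz2 r
          refine ⟨?_, ?_, ?_⟩
          · change (g ⟨i, r⟩ : D × (Idx n →₀ S)).2 ∈ below S n i
            rwa [hgr]
          · beta_reduce
            rw [hgr, totalD_congr (fun s hs => by rw [hgf s hs]) h1]
            exact h2
          · change ((g ⟨i, r⟩ : D × (Idx n →₀ S)), b i r) ∈ rep P b i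
            rwa [hgr]
        · have hi : i < k := lt_of_le_of_ne (Nat.lt_succ_iff.1 hr) h
          exact (hf ⟨i, r⟩ hi).congr fun s hs => by rw [hgf s (lt_of_le_of_lt hs hi)]
      exact ⟨g, hgf, hg, (hk.congr fun s hs => by rw [hgf s hs]).succ hg⟩)
  exact ⟨fun r => Λ r, fun r => (Λ r).2,
    fun r => (hΛ (r.1 + 1)).1 r (Nat.lt_succ_self _), fun k => (hΛ k).2⟩

end FlagRes

/-! ### The flag as a resolution of `D`, and its minimality -/

namespace FlagRes

variable {S : Type u} [CommRing S] {𝒜 : ℕ → AddSubgroup S} [GradedRing 𝒜] [IsLocalRing (𝒜 0)]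
  {a : ℤ} {D : DM 𝒜 a} {P : MinFreeRes D.homology} {n : ℕ → ℕ}
  {b : ∀ i, Module.Basis (Fin (n i)) S (P.F i)} {Λ : Idx n → D × (Idx n →₀ S)}

omit [GradedRing 𝒜] [IsLocalRing (𝒜 0)] in
theorem exists_mem_below (f : Idx n →₀ S) : ∃ k, f ∈ below S n k :=
  ⟨f.support.sup Sigma.fst + 1, (Finsupp.mem_supported S f).2 fun _ hs =>
    Nat.lt_succ_iff.2 (Finset.le_sup (f := Sigma.fst) hs)⟩

/-- By finite support a cycle lives at some stage `k`. Its class is represented by some `p ∈ F k`,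
so it bounds once `F k` is attached. -/
theorem exists_totalD_eq (hg : ∀ r, IsGood P b Λ r) (he : ∀ k, ExactAt P b Λ k)
    (z : D × (Idx n →₀ S)) (hz : totalD D Λ z = 0) : ∃ w, totalD D Λ w = z := by
  obtain ⟨k, hk⟩ := exists_mem_below z.2
  obtain ⟨p, hp⟩ := (he k).exists_rep z hk hz
  obtain ⟨h1, h2, h3⟩ := totalD_incl (P := P) (b := b) (Λ := Λ) (k := k) (fun r _ => hg r) p
  obtain ⟨w, -, hw⟩ := (he k).exists_bound (z - totalD D Λ (0, incl P b k p)) (sub_mem hk h1)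
    (by rw [map_sub, hz, h2, sub_zero]) (by simpa using sub_mem hp h3)
  exact ⟨w + (0, incl P b k p), by rw [map_add, hw, sub_add_cancel]⟩

variable (n a) in
/-- The degrees of the basis elements of the flag. -/
def flagDeg (dg : ℕ → ℤ) (r : Idx n) : ℤ := dg r.1 - r.1 * a

omit [GradedRing 𝒜] [IsLocalRing (𝒜 0)] in
theorem degPiece_flagDeg (dg : ℕ → ℤ) (k : ℤ) :
    degPiece 𝒜 (flagDeg a n dg) (k + a) = degPiece 𝒜 (coneDeg a n dg) k := by
  have : ∀ r, k + a - flagDeg a n dg r = k - coneDeg a n dg r := fun r => by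
    rw [flagDeg, coneDeg]; ring
  ext f
  rw [mem_degPiece, mem_degPiece]
  exact forall_congr' fun r => by rw [this]

variable (Λ) in
/-- The differential of the flag. -/
def flagD : (Idx n →₀ S) →ₗ[S] (Idx n →₀ S) :=
  -(LinearMap.snd S D (Idx n →₀ S) ∘ₗ totalD D Λ ∘ₗ LinearMap.inr S D (Idx n →₀ S))

omit [GradedRing 𝒜] [IsLocalRing (𝒜 0)] in
theorem flagD_apply (f : Idx n →₀ S) : flagD Λ f = -(totalD D Λ (0, f)).2 := rfl

/-- The flag `⨁ F i` with the differential determined by `Λ`. -/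
abbrev flag {dg : ℕ → ℤ} (hΛ : ∀ r, Λ r ∈ (cone D n dg).piece (coneDeg a n dg r + a))
    (hdd : ∀ z, totalD D Λ (totalD D Λ z) = 0) : DM 𝒜 a where
  toGrMod := GrMod.ofDegrees 𝒜 (flagDeg a n dg)
  d := flagD Λ
  d_mem := by
    intro k f hf
    have hf' : f ∈ degPiece 𝒜 (coneDeg a n dg) (k - a) := by
      rwa [← degPiece_flagDeg, sub_add_cancel]
    have := (totalD_mem hΛ (z := (0, f)) ⟨zero_mem _, hf'⟩).2
    rw [sub_add_cancel] at this
    change _ ∈ degPiece 𝒜 (flagDeg a n dg) (k + a)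
    rw [degPiece_flagDeg]
    exact neg_mem this
  d_d := by
    intro f
    have h := congrArg Prod.snd (hdd (0, f))
    rw [totalD_apply Λ (totalD D Λ (0, f)), Prod.snd_add, zero_add] at h
    change -(totalD D Λ (0, -(totalD D Λ (0, f)).2)).2 = 0
    rw [totalD_apply, Prod.snd_add, zero_add, map_neg, Prod.snd_neg, neg_neg]
    exact h

/-- The map from the flag to `D`. -/
def flagHom {dg : ℕ → ℤ} (hΛ : ∀ r, Λ r ∈ (cone D n dg).piece (coneDeg a n dg r + a))
    (hdd : ∀ z, totalD D Λ (totalD D Λ z) = 0) : DM.Hom (flag hΛ hdd) D where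
  toFun := LinearMap.fst S D (Idx n →₀ S) ∘ₗ totalD D Λ ∘ₗ LinearMap.inr S D (Idx n →₀ S)
  graded := by
    intro k f hf
    have hf' : f ∈ degPiece 𝒜 (coneDeg a n dg) (k - a) := by
      rw [← degPiece_flagDeg, sub_add_cancel]
      exact hf
    have := (totalD_mem hΛ (z := (0, f)) ⟨zero_mem _, hf'⟩).1
    rwa [sub_add_cancel] at this
  comm := by
    intro f
    have h := congrArg Prod.fst (hdd (0, f))
    rw [totalD_apply Λ (totalD D Λ (0, f)), Prod.fst_add] at h
    change (totalD D Λ (0, -(totalD D Λ (0, f)).2)).1 = D.d (totalD D Λ (0, f)).1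
    rw [totalD_apply, Prod.fst_add, map_zero, zero_add, map_neg, Prod.fst_neg]
    exact (eq_neg_of_add_eq_zero_left h).symm

omit [IsLocalRing (𝒜 0)] in
-- The total space is, up to signs, the mapping cone of the flag over `D`; its acyclicity is applied
-- to the cycles `(-y, f)` and `(y, 0)`.
theorem flagHom_isQuasiIso {dg : ℕ → ℤ}
    (hΛ : ∀ r, Λ r ∈ (cone D n dg).piece (coneDeg a n dg r + a))
    (hdd : ∀ z, totalD D Λ (totalD D Λ z) = 0)
    (hac : ∀ z, totalD D Λ z = 0 → ∃ w, totalD D Λ w = z) : (flagHom hΛ hdd).IsQuasiIso := by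
  rw [DM.Hom.isQuasiIso_iff]
  have hφ : ∀ f : Idx n →₀ S, (flagHom hΛ hdd).toFun f = (totalD D Λ (0, f)).1 := fun _ => rfl
  have hsplit : ∀ (y : D) (f : Idx n →₀ S), totalD D Λ (y, f) = (D.d y, 0) + totalD D Λ (0, f) := by
    intro y f
    rw [totalD_apply, totalD_apply, map_zero, Prod.mk_zero_zero, zero_add]
  constructor
  · intro f y hf hfy
    replace hf : flagD Λ f = 0 := hf
    rw [flagD_apply, neg_eq_zero] at hf
    rw [hφ] at hfy
    obtain ⟨⟨y', f'⟩, hw⟩ := hac (-y, f) (by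
      rw [hsplit, map_neg, ← hfy]
      exact Prod.ext (by simp) (by simp [hf]))
    refine ⟨-f', ?_⟩
    have h2 := congrArg Prod.snd hw
    rw [hsplit, Prod.snd_add, zero_add] at h2
    change flagD Λ (-f') = f
    rw [map_neg, flagD_apply, neg_neg]
    exact h2
  · intro y hy
    obtain ⟨⟨y', f⟩, hw⟩ := hac (y, 0) (by rw [totalD_apply, hy, map_zero]; exact add_zero _)
    rw [hsplit] at hw
    have h1 := congrArg Prod.fst hw
    have h2 := congrArg Prod.snd hw
    rw [Prod.fst_add] at h1
    rw [Prod.snd_add, zero_add] at h2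
    refine ⟨f, y', ?_, ?_⟩
    · change flagD Λ f = 0
      rw [flagD_apply, neg_eq_zero]
      exact h2
    · rw [hφ, add_comm]
      exact h1

/-- The basis of the flag. -/
def flagBasis (S : Type u) [CommRing S] (n : ℕ → ℕ) :
    Module.Basis (ULift.{u} (Idx n)) S (Idx n →₀ S) :=
  Finsupp.basisSingleOne.reindex Equiv.ulift.symm

theorem flagBasis_apply (r : ULift.{u} (Idx n)) :
    flagBasis S n r = Finsupp.single r.down 1 := by
  simp [flagBasis, Module.Basis.reindex_apply]

theorem span_flagBasis (k : ℕ) :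
    Submodule.span S (flagBasis S n '' {s | s.down.1 < k}) = below S n k := by
  rw [below, Finsupp.supported_eq_span_single]
  congr 1
  ext f
  constructor
  · rintro ⟨s, hs, rfl⟩
    exact ⟨s.down, hs, (flagBasis_apply s).symm⟩
  · rintro ⟨s, hs, rfl⟩
    exact ⟨⟨s⟩, hs, flagBasis_apply _⟩

omit [GradedRing 𝒜] [IsLocalRing (𝒜 0)] in
theorem snd_totalD_single (r : Idx n) :
    (totalD D Λ (0, Finsupp.single r 1)).2 = (Λ r).2 := by
  simp [totalD_apply]

omit [IsLocalRing (𝒜 0)] in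
theorem flagBasis_mem {dg : ℕ → ℤ}
    (hΛ : ∀ r, Λ r ∈ (cone D n dg).piece (coneDeg a n dg r + a))
    (hdd : ∀ z, totalD D Λ (totalD D Λ z) = 0) (r : ULift.{u} (Idx n)) :
    flagBasis S n r ∈ (flag hΛ hdd).piece (flagDeg a n dg r.down) := by
  rw [flagBasis_apply]
  exact single_one_mem_degPiece r.down

theorem flag_isFree {dg : ℕ → ℤ}
    (hΛ : ∀ r, Λ r ∈ (cone D n dg).piece (coneDeg a n dg r + a))
    (hdd : ∀ z, totalD D Λ (totalD D Λ z) = 0) : (flag hΛ hdd).toGrMod.IsFree :=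
  ⟨ULift.{u} (Idx n), flagBasis S n, fun r => ⟨_, flagBasis_mem hΛ hdd r⟩⟩

theorem flag_isFreeFlag {dg : ℕ → ℤ}
    (hΛ : ∀ r, Λ r ∈ (cone D n dg).piece (coneDeg a n dg r + a))
    (hdd : ∀ z, totalD D Λ (totalD D Λ z) = 0) (hg : ∀ r, IsGood P b Λ r) :
    (flag hΛ hdd).IsFreeFlag := by
  refine ⟨ULift.{u} (Idx n), flagBasis S n, fun r => r.down.1,
    fun r => ⟨_, flagBasis_mem hΛ hdd r⟩, fun r => ?_⟩
  change flagD Λ (flagBasis S n r) ∈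
    Submodule.span S (flagBasis S n '' {s | s.down.1 < r.down.1})
  rw [span_flagBasis, flagBasis_apply, flagD_apply, snd_totalD_single]
  exact neg_mem (hg r.down).1

/-- An entry from `F i` to `F k` vanishes for `k ≥ i`, and for `k = i - 1` it is an entry of the
minimal `δ` up to sign. For `j = i - k ≥ 2` it is homogeneous of degree `dg i - dg (i - j) + a * (1
- j)`, which `hnd` makes nonzero. -/
theorem flag_isMinimal {dg : ℕ → ℤ}
    (hΛ : ∀ r, Λ r ∈ (cone D n dg).piece (coneDeg a n dg r + a))
    (hdd : ∀ z, totalD D Λ (totalD D Λ z) = 0) (hg : ∀ r, IsGood P b Λ r)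
    (hnd : ∀ i j, 2 ≤ j → j ≤ i → n i ≠ 0 → a * (1 - (j : ℤ)) ≠ dg (i - j) - dg i) :
    (flag hΛ hdd).IsMinimal := by
  have hcoef : ∀ r s : Idx n, (Λ r).2 s ∈ homMaxIdeal 𝒜 := by
    rintro ⟨i, r⟩ ⟨k, s⟩
    rcases Nat.lt_trichotomy i (k + 1) with h | h | h
    · rw [mem_below.1 (hg ⟨i, r⟩).1 ⟨k, s⟩ (Nat.lt_succ_iff.1 h)]
      exact zero_mem _
    · subst h
      have := (mem_rep_succ P b).1 (hg ⟨k + 1, r⟩).2.2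
      rw [← repr_proj P b, this]
      exact (baseChange_eq_zero_iff (b k) _ _).1 (P.minimal k) _ _
    · refine intPiece_le_homMaxIdeal ?_ ((hΛ ⟨i, r⟩).2 ⟨k, s⟩)
      have := hnd i (i - k) (by omega) (by omega) (Fin.pos r).ne'
      rw [Nat.sub_sub_self (by omega), Nat.cast_sub (by omega)] at this
      simp only [coneDeg]
      intro h0
      apply this
      linear_combination h0
  refine (baseChange_eq_zero_iff (flagBasis S n) _ (flagD Λ)).2 fun f r => ?_
  change (flagBasis S n).repr (flagD Λ f) r ∈ homMaxIdeal 𝒜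
  rw [flagBasis, Module.Basis.repr_reindex_apply, flagD_apply]
  change -(totalD D Λ (0, f)).2 r.down ∈ homMaxIdeal 𝒜
  refine neg_mem ?_
  rw [totalD_apply, Prod.snd_add, zero_add, Finsupp.linearCombination_apply, Finsupp.sum,
    Prod.snd_sum, Finsupp.finsetSum_apply]
  exact sum_mem fun s _ => Ideal.mul_mem_left _ _ (hcoef s r.down)

end FlagRes

/-! ### The homology of a zero endomorphism -/

section ZeroHomology

variable {R M : Type*} [CommRing R] [AddCommGroup M] [Module R M]

/-- The identification of a module with the homology of its zero endomorphism. -/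
def toHlgyOfZero (d : M →ₗ[R] M) (hd : d = 0) : M →ₗ[R] Hlgy d :=
  Submodule.mkQ _ ∘ₗ LinearMap.id.codRestrict (LinearMap.ker d) (fun x => by simp [hd])

theorem toHlgyOfZero_bijective (d : M →ₗ[R] M) (hd : d = 0) :
    Function.Bijective (toHlgyOfZero d hd) := by
  constructor
  · rw [injective_iff_map_eq_zero]
    intro x hx
    obtain ⟨w, hw⟩ := (Submodule.Quotient.mk_eq_zero _).1 hx
    have hw' : d w = x := hw
    rw [← hw', hd, LinearMap.zero_apply]
  · intro y
    obtain ⟨x, rfl⟩ := Submodule.Quotient.mk_surjective _ y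
    exact ⟨x, rfl⟩

end ZeroHomology

/-! ### Betti numbers from pure resolutions -/

section Pure

variable {S : Type u} [CommRing S] {𝒜 : ℕ → AddSubgroup S} [GradedRing 𝒜] [IsLocalRing (𝒜 0)]
  {a : ℤ}

/-- The homology of `H(D)` is `H(D)`, so a resolution of one is a resolution of the other. -/
def MinFreeRes.ofHomology {D : DM 𝒜 a} (P : MinFreeRes D.homology) :
    MinFreeRes (DM.ofGrMod a D.homology).homology where
  F := P.F
  free := P.free
  finite := P.finite
  δ := P.δ
  δ_graded := P.δ_graded
  ε := (toHlgyOfZero (DM.ofGrMod a D.homology).d rfl : _ →ₗ[S] _) ∘ₗ P.ε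
  ε_graded k m hm := ⟨⟨P.ε m, rfl⟩, P.ε_graded k m hm, rfl⟩
  ε_surjective := (toHlgyOfZero_bijective (DM.ofGrMod a D.homology).d rfl).2.comp P.ε_surjective
  exact_zero x := by
    rw [← P.exact_zero x]
    exact map_eq_zero_iff (toHlgyOfZero (DM.ofGrMod a D.homology).d rfl)
      (toHlgyOfZero_bijective (DM.ofGrMod a D.homology).d rfl).1
  exact_succ := P.exact_succ
  minimal := P.minimal

theorem nontrivial_of_isLocalRing (𝒜 : ℕ → AddSubgroup S) [GradedRing 𝒜] [IsLocalRing (𝒜 0)] :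
    Nontrivial S :=
  (Ideal.Quotient.mk (homMaxIdeal 𝒜)).domain_nontrivial

theorem MinFreeRes.IsPure.exists_basis {M : GrMod 𝒜} {P : MinFreeRes M} {ℓ : ℕ} {d : ℕ → ℤ}
    (hP : P.IsPure ℓ d) :
    ∃ (n : ℕ → ℕ) (b : ∀ i, Module.Basis (Fin (n i)) S (P.F i)),
      (∀ i r, b i r ∈ (P.F i).piece (d i)) ∧ ∀ i, n i ≠ 0 ↔ i ≤ ℓ := by
  have : ∀ i, ∃ (n : ℕ) (b : Module.Basis (Fin n) S (P.F i)),
      (∀ r, b r ∈ (P.F i).piece (d i)) ∧ (n ≠ 0 ↔ i ≤ ℓ) := by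
    intro i
    rcases le_or_gt i ℓ with h | h
    · obtain ⟨n, b, hn, hb⟩ := hP.1 i h
      exact ⟨n, b, hb, fun _ => h, fun _ => hn.ne'⟩
    · have := hP.2 i h
      exact ⟨0, Module.Basis.empty _, fun r => r.elim0, fun h' => absurd rfl h',
        fun h' => absurd h' (not_le.2 h)⟩
  choose n b h using this
  exact ⟨n, b, fun i => (h i).1, fun i => (h i).2⟩

/-- By minimality the homology of `F ⊗ 𝕜` is `F ⊗ 𝕜` itself. -/
theorem DM.resDim_of_isMinimal {F : DM 𝒜 a} (hF : F.IsMinimal) {ι : Type u}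
    (b : Module.Basis ι S F) : F.resDim = Cardinal.toENat (Cardinal.mk ι) := by
  rw [DM.resDim, (b.baseChange (ResField 𝒜)).mk_eq_rank'',
    (LinearEquiv.ofBijective _ (toHlgyOfZero_bijective F.dRes hF)).rank_eq]

/-- If the degrees `d i` are such that no block `F i → F (i - j)`, `j ≥ 2`, of the flag can have
entries of degree zero, then the total Betti number is the sum of the Betti numbers. -/
theorem MinFreeRes.IsPure.totalBetti_eq {D : DM 𝒜 a} {P : MinFreeRes D.homology} {ℓ : ℕ}
    {d : ℕ → ℤ} (hP : P.IsPure ℓ d)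
    (hnd : ∀ i j, 2 ≤ j → j ≤ i → i ≤ ℓ → a * (1 - (j : ℤ)) ≠ d (i - j) - d i) :
    D.totalBetti = ((∑ i ∈ Finset.range (ℓ + 1), P.betti i : ℕ) : ℕ∞) := by
  have := nontrivial_of_isLocalRing 𝒜
  obtain ⟨n, b, hb, hn⟩ := hP.exists_basis
  obtain ⟨Λ, hΛ, hg, he⟩ := FlagRes.exists_good P b hb
  have hdd : ∀ z, FlagRes.totalD D Λ (FlagRes.totalD D Λ z) = 0 := by
    intro z
    obtain ⟨k, hk⟩ := FlagRes.exists_mem_below z.2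
    exact FlagRes.totalD_totalD (fun r _ => (hg r).2.1) hk
  set F := FlagRes.flag hΛ hdd with hF
  set φ : DM.Hom F D := FlagRes.flagHom hΛ hdd
  have hφ : φ.IsQuasiIso := FlagRes.flagHom_isQuasiIso hΛ hdd (FlagRes.exists_totalD_eq hg he)
  have hflag : F.IsFreeFlag := FlagRes.flag_isFreeFlag hΛ hdd hg
  have hmin : F.IsMinimal :=
    FlagRes.flag_isMinimal hΛ hdd hg fun i j h2 hj hi => hnd i j h2 hj ((hn i).1 hi)
  let idF : DM.Hom F F := ⟨LinearMap.id, fun _ _ h => h, fun _ => rfl⟩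
  -- A minimal flag is a direct summand of itself, so no splitting is needed.
  have hres : F.IsMinimalFreeResolution D :=
    ⟨FlagRes.flag_isFree hΛ hdd, hmin, F, φ, idF, idF, hflag, hφ, fun _ => rfl, hφ⟩
  have hdim : F.resDim = ((∑ i ∈ Finset.range (ℓ + 1), P.betti i : ℕ) : ℕ∞) := by
    rw [DM.resDim_of_isMinimal hmin (FlagRes.flagBasis S n : Module.Basis _ S F)]
    let e : FlagRes.Idx n ≃ Σ i : Fin (ℓ + 1), Fin (n i) :=
      { toFun := fun r => ⟨⟨r.1, Nat.lt_succ_iff.2 ((hn r.1).1 (Fin.pos r.2).ne')⟩, r.2⟩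
        invFun := fun r => ⟨r.1, r.2⟩
        left_inv := fun _ => rfl
        right_inv := fun _ => rfl }
    rw [Cardinal.mk_congr (Equiv.ulift.trans (e.trans Equiv.ulift.{u}.symm)), Cardinal.mk_fintype,
      Fintype.card_ulift, Fintype.card_sigma, Cardinal.toENat_nat]
    simp only [Fintype.card_fin]
    rw [Fin.sum_univ_eq_sum_range]
    congr 1
    refine Finset.sum_congr rfl fun i _ => ?_
    rw [MinFreeRes.betti, Module.finrank_eq_card_basis (b i), Fintype.card_fin]
  rw [← hdim]
  exact le_antisymm (iInf₂_le F hres) (le_iInf₂ fun G hG => hflag.resDim_le φ hφ hG)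

/-- Over a graded ring whose degree zero part is a field, the degrees of a pure resolution
increase. -/
theorem MinFreeRes.IsPure.strictMonoOn {M : GrMod 𝒜} {P : MinFreeRes M} {ℓ : ℕ} {d : ℕ → ℤ}
    (hP : P.IsPure ℓ d) (hfield : IsField (𝒜 0)) : StrictMonoOn d (Set.Iic ℓ) := by
  obtain ⟨n, b, hb, hn⟩ := hP.exists_basis
  refine strictMonoOn_Iic_of_lt_succ fun i hi => ?_
  rw [Nat.succ_eq_succ]
  by_contra hlt
  rw [not_lt] at hlt
  have hcoef : ∀ i x r, (b i).repr (P.δ i x) r ∈ homMaxIdeal 𝒜 := fun i =>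
    (baseChange_eq_zero_iff (b i) _ _).1 (P.minimal i)
  -- If `d (i + 1) ≤ d i`, the entries of `δ i` have degree at most zero and lie in the homogeneous
  -- maximal ideal, which vanishes in degree zero over a field.
  have hδ : P.δ i = 0 := by
    refine (b (i + 1)).ext fun r => (b i).repr.injective (Finsupp.ext fun s => ?_)
    have h1 : (b i).repr (P.δ i (b (i + 1) r)) s ∈ intPiece 𝒜 (d (i + 1) - d i) :=
      GrMod.repr_mem_degPiece (deg := fun _ => d i) (b i) (hb i) (P.δ_graded i _ _ (hb (i + 1) r)) s
    rw [LinearMap.zero_apply, map_zero, Finsupp.zero_apply]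
    rcases hlt.lt_or_eq with h | h
    · rwa [intPiece_of_neg (sub_neg.2 h), AddSubgroup.mem_bot] at h1
    · exact eq_zero_of_mem_homMaxIdeal hfield (by rwa [← sub_eq_zero.2 h]) (hcoef _ _ _)
  have hpos : 0 < n (i + 1) := Nat.pos_of_ne_zero ((hn _).2 hi)
  -- As `δ i = 0`, exactness puts a basis vector of `F (i + 1)` in the image of `δ (i + 1)`;
  -- minimality then places its coefficient `1` in the maximal ideal.
  obtain ⟨q, hq⟩ := (P.exact_succ i (b (i + 1) ⟨0, hpos⟩)).1 (by rw [hδ]; rfl)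
  have h1 := hcoef (i + 1) q ⟨0, hpos⟩
  rw [hq, Module.Basis.repr_self, Finsupp.single_eq_same] at h1
  exact homMaxIdeal_ne_top ((Ideal.eq_top_iff_one _).2 h1)

end Pure

end DiffModule

end

/-! ### The main theorem -/

theorem mainTheorem11 {S : Type*} [CommRing S] [IsNoetherianRing S]
    (𝒜 : ℕ → AddSubgroup S) [GradedRing 𝒜] [IsLocalRing (𝒜 0)]
    (a : ℤ) (D : DiffModule.DM 𝒜 a) (hD : Module.Finite S D)
    (P : DiffModule.MinFreeRes D.homology) (ℓ : ℕ) (d : ℕ → ℤ) (hP : P.IsPure ℓ d) :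
    (D.IsBettiDeficient →
      ∃ i j : ℕ, 2 ≤ j ∧ j ≤ i ∧ i ≤ ℓ ∧
        (a : ℚ) = ((d (i - j) : ℚ) - (d i : ℚ)) / (1 - (j : ℚ))) ∧
    (a = 0 → (IsField (𝒜 0) ∨ StrictMonoOn d (Set.Iic ℓ)) →
      ¬ D.IsBettiDeficient ∧
        D.totalBetti = ((∑ i ∈ Finset.range (ℓ + 1), P.betti i : ℕ) : ℕ∞)) := by
  have key : (∀ i j, 2 ≤ j → j ≤ i → i ≤ ℓ → a * (1 - (j : ℤ)) ≠ d (i - j) - d i) →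
      ¬ D.IsBettiDeficient ∧
        D.totalBetti = ((∑ i ∈ Finset.range (ℓ + 1), P.betti i : ℕ) : ℕ∞) := by
    intro hnd
    -- The degree condition involves only `a` and `d`, so the same computation applies to `H(D)`
    -- with zero differential.
    have hP' : P.ofHomology.IsPure ℓ d := hP
    have h1 := hP.totalBetti_eq hnd
    refine ⟨fun hdef => ne_of_lt hdef ?_, h1⟩
    rw [h1, hP'.totalBetti_eq hnd]
    rfl
  constructor
  · intro hdef
    by_contra hcon
    refine (key fun i j h2 hj hi h => hcon ⟨i, j, h2, hj, hi, ?_⟩).1 hdef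
    have hj' : (1 - (j : ℚ)) ≠ 0 := by
      have : (2 : ℚ) ≤ j := by exact_mod_cast h2
      linarith
    rw [eq_div_iff hj']
    exact_mod_cast h
  · rintro rfl hor
    have hmono : StrictMonoOn d (Set.Iic ℓ) := hor.elim (fun h => hP.strictMonoOn h) id
    refine key fun i j h2 hj hi h => ?_
    have : d (i - j) < d i := hmono (Set.mem_Iic.2 (by omega)) (Set.mem_Iic.2 hi) (by omega)
    rw [zero_mul] at h
    omega
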